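/- Let $k$ be a field and $k[\varepsilon]=k[t]/(t^2)$. Let $\mathcal K$ be the homotopy category of unbounded complexes of $k[\varepsilon]$-modules and $D(\mathrm{Mod}\,k[\varepsilon])$ the unbounded derived category. *The category $\widehat{\mathcal S}$.* Its objects are the sequences $V=(V^i,d_V^i)_{i\in\mathbb Z}$ of $k$-vector spaces $V^i$ and $k$-linear maps $d_V^i\colon V^i\to V^{i+1}$, with no condition on the composites. Set $$\mathrm{Hom}_{\widehat{\mathcal S}}(V,W)=\mathrm{Hom}_1(V,W)\oplus \mathrm{Hom}_\varepsilon(V,W),$$ where $\mathrm{Hom}_1(V,W)$ is the space of families $f^i\colon V^i\to W^i$ with $d_W^if^i=f^{i+1}d_V^i$ for all $i$, and $\mathrm{Hom}_\varepsilon(V,W)$ is the cokernel of $$\prod_i\mathrm{Hom}_k(V^i,W^{i-1})\to\prod_i\mathrm{Hom}_k(V^i,W^i),\qquad (h^i)_i\mapsto(d_W^{i-1}h^i+h^{i+1}d_V^i)_i .$$ Composition is $(g_1+[g_\varepsilon])\circ(f_1+[f_\varepsilon])=g_1f_1+[g_1f_\varepsilon+g_\varepsilon f_1]$, and the shift is $V[n]^i=V^{n+i}$,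 $d_{V[n]}^i=(-1)^nd_V^{n+i}$. *Minimal complexes.* Let $\mathcal K_m\subseteq\mathcal K$ be the full subcategory of the complexes $M$ of free $k[\varepsilon]$-modules such that each differential $M^i\to M^{i+1}$ is $\varepsilon$ times a $k[\varepsilon]$-linear map. There is a functor $\Phi\colon\widehat{\mathcal S}\to\mathcal K_m$ sending $V$ to the complex with terms $V^i\otimes_kk[\varepsilon]$ and differentials $\varepsilon d_V^i$, and $f_1+[f_\varepsilon]$ to the homotopy class of $f_1+\varepsilon f_\varepsilon$; it commutes with the shifts. *Statement.* 1. $\Phi$ is a $k$-linear equivalence of categories, $\mathcal K_m$ is a triangulated subcategory of $\mathcal K$ (it is stable under shifts, and its closure under isomorphism is closed under extensions), and $\widehat{\mathcal S}$ is a triangulated category when its distinguished triangles are taken to be those which $\Phi$ sends to distinguished triangles of $\mathcal K_m$. 2. Let $\widehat{\mathcal S}_a$ (respectively $\widehat{\mathcal S}_p$) be the full subcategory of the $V\in\widehat{\mathcal S}$ such that $\Phi(V)$ is acyclic (respectively h-projective, that is, $\mathrm{Hom}_{\mathcal K}(\Phi(V),N)=0$ for every acyclic complex $N$ of $k[\varepsilon]$-modules).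 Then there is a semiorthogonal decomposition $\widehat{\mathcal S}=\langle\widehat{\mathcal S}_a,\widehat{\mathcal S}_p\rangle$: both are strictly full triangulated subcategories, $\mathrm{Hom}_{\widehat{\mathcal S}}(P,A)=0$ for all $P\in\widehat{\mathcal S}_p$ and $A\in\widehat{\mathcal S}_a$, and every $X\in\widehat{\mathcal S}$ lies in a distinguished triangle $P\to X\to A\to P[1]$ with $P\in\widehat{\mathcal S}_p$ and $A\in\widehat{\mathcal S}_a$. 3. There is an exact $k$-linear equivalence $\widehat{\mathcal S}_p\simeq D(\mathrm{Mod}\,k[\varepsilon])$. -/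

import Mathlib

open CategoryTheory Limits
open scoped TensorProduct

universe w u

/-- A sequence of `k`-vector spaces: spaces `X i` and linear maps `X i → X (i + 1)` for `i : ℤ`,
with no condition on composites. The map `X i → X (i + 1)` is recorded as `d i j` for every `j`
with `i + 1 = j`. The type of sequences is the type of objects of the category `Ŝ` defined below,
hence the name. -/
structure SHat (k : Type u) [Field k] where
  /-- the spaces -/
  X : ℤ → ModuleCat.{u} k
  /-- the maps -/
  d : ∀ i j : ℤ, i + 1 = j → (X i →ₗ[k] X j)

namespace SHat

variable {k : Type u} [Field k]

/-- Families of linear maps of degree `0`. -/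
abbrev Hom0 (V W : SHat k) : Type u := ∀ i : ℤ, V.X i →ₗ[k] W.X i

/-- Families of linear maps of degree `-1`, indexed by the pairs `(i, j)` with `j + 1 = i`. -/
abbrev HomNeg (V W : SHat k) : Type u :=
  ∀ p : {p : ℤ × ℤ // p.2 + 1 = p.1}, V.X p.1.1 →ₗ[k] W.X p.1.2

/-- The differential of the Hom sequence from degree `-1` to degree `0`:
`δ(h)^i = d_W^{i-1} h^i - (-1)^{-1} h^{i+1} d_V^i`. -/
def delta (V W : SHat k) : HomNeg V W →ₗ[k] Hom0 V W where
  toFun h := fun i =>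
    W.d (i - 1) i (sub_add_cancel i 1) ∘ₗ h ⟨(i, i - 1), sub_add_cancel i 1⟩ +
      h ⟨(i + 1, i), rfl⟩ ∘ₗ V.d i (i + 1) rfl
  map_add' h h' := by
    funext i
    simp only [Pi.add_apply, LinearMap.comp_add, LinearMap.add_comp]
    abel
  map_smul' c h := by
    funext i
    simp only [Pi.smul_apply, LinearMap.comp_smul, LinearMap.smul_comp, smul_add, RingHom.id_apply]

lemma delta_apply (V W : SHat k) (h : HomNeg V W) {i j l : ℤ} (hij : i + 1 = j) (hjl : j + 1 = l) :
    delta V W h j = W.d i j hij ∘ₗ h ⟨(j, i), hij⟩ + h ⟨(l, j), hjl⟩ ∘ₗ V.d j l hjl := by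
  obtain rfl : i = j - 1 := by lia
  subst hjl
  rfl

/-- Morphisms of sequences: the families of degree `0` commuting with the maps `d`. -/
def HomOne (V W : SHat k) : Submodule k (Hom0 V W) where
  carrier := {f | ∀ (i j : ℤ) (h : i + 1 = j), W.d i j h ∘ₗ f i = f j ∘ₗ V.d i j h}
  add_mem' hf hg := fun i j h => by
    simp only [Pi.add_apply, LinearMap.comp_add, LinearMap.add_comp, hf i j h, hg i j h]
  zero_mem' := fun i j h => by simp
  smul_mem' c f hf := fun i j h => by
    simp only [Pi.smul_apply, LinearMap.comp_smul, LinearMap.smul_comp, hf i j h]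

/-- The cokernel of the differential from degree `-1` to degree `0` of the Hom sequence. -/
abbrev HomEps (V W : SHat k) : Type u := Hom0 V W ⧸ LinearMap.range (delta V W)

/-- The class of a family of degree `0`. -/
abbrev cls {V W : SHat k} (f : Hom0 V W) : HomEps V W := Submodule.Quotient.mk f

/-- Composition with a morphism of sequences on the left: `[f] ↦ [g ∘ f]`. -/
def postcomp {V W Z : SHat k} (g : HomOne W Z) : HomEps V W →ₗ[k] HomEps V Z :=
  Submodule.mapQ _ _
    { toFun := fun f i => g.1 i ∘ₗ f i
      map_add' := fun f f' => by funext i; simp only [Pi.add_apply, LinearMap.comp_add]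
      map_smul' := fun c f => by
        funext i; simp only [Pi.smul_apply, LinearMap.comp_smul, RingHom.id_apply] }
    (by
      rintro _ ⟨h, rfl⟩
      refine ⟨fun p => g.1 p.1.2 ∘ₗ h p, ?_⟩
      funext i
      have e := g.2 (i - 1) i (by lia)
      simp only [delta_apply _ _ _ (show i - 1 + 1 = i by lia) rfl, LinearMap.coe_mk,
        AddHom.coe_mk, LinearMap.comp_add, ← LinearMap.comp_assoc, e])

/-- Composition with a morphism of sequences on the right: `[g] ↦ [g ∘ f]`. -/
def precomp {V W Z : SHat k} (f : HomOne V W) : HomEps W Z →ₗ[k] HomEps V Z :=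
  Submodule.mapQ _ _
    { toFun := fun g i => g i ∘ₗ f.1 i
      map_add' := fun g g' => by funext i; simp only [Pi.add_apply, LinearMap.add_comp]
      map_smul' := fun c g => by
        funext i; simp only [Pi.smul_apply, LinearMap.smul_comp, RingHom.id_apply] }
    (by
      rintro _ ⟨h, rfl⟩
      refine ⟨fun p => h p ∘ₗ f.1 p.1.1, ?_⟩
      funext i
      have e := f.2 i (i + 1) rfl
      simp only [delta_apply _ _ _ (show i - 1 + 1 = i by lia) rfl, LinearMap.coe_mk,
        AddHom.coe_mk, LinearMap.add_comp, LinearMap.comp_assoc, e])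

@[simp]
lemma postcomp_cls {V W Z : SHat k} (g : HomOne W Z) (f : Hom0 V W) :
    postcomp g (cls f) = cls fun i => g.1 i ∘ₗ f i := rfl

@[simp]
lemma precomp_cls {V W Z : SHat k} (f : HomOne V W) (g : Hom0 W Z) :
    precomp f (cls g) = cls fun i => g i ∘ₗ f.1 i := rfl

/-- The identity of a sequence. -/
def idOne (V : SHat k) : HomOne V V := ⟨fun _ => LinearMap.id, fun _ _ _ => rfl⟩

/-- The composition `g ∘ f` of morphisms of sequences. -/
def compOne {V W Z : SHat k} (f : HomOne V W) (g : HomOne W Z) : HomOne V Z :=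
  ⟨fun i => g.1 i ∘ₗ f.1 i, fun i j h => by
    rw [← LinearMap.comp_assoc, g.2 i j h, LinearMap.comp_assoc, f.2 i j h, LinearMap.comp_assoc]⟩

/-- The category `Ŝ`: the objects are the sequences, a morphism is a pair `f₁ + [f_ε]` of a
morphism of sequences and a class of families of degree `0`, and
`(g₁ + [g_ε]) ∘ (f₁ + [f_ε]) = g₁ f₁ + [g₁ f_ε + g_ε f₁]`. -/
instance : Category (SHat k) where
  Hom V W := HomOne V W × HomEps V W
  id V := (idOne V, 0)
  comp f g := (compOne f.1 g.1, postcomp g.1 f.2 + precomp f.1 g.2)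
  id_comp := by
    rintro V W ⟨f, ⟨e⟩⟩
    refine Prod.ext rfl ?_
    change postcomp f 0 + precomp _ (cls e) = cls e
    rw [map_zero, zero_add]
    rfl
  comp_id := by
    rintro V W ⟨f, ⟨e⟩⟩
    refine Prod.ext rfl ?_
    change postcomp _ (cls e) + precomp f 0 = cls e
    rw [map_zero, add_zero]
    rfl
  assoc := by
    rintro V W Y Z ⟨f, ⟨a⟩⟩ ⟨g, ⟨b⟩⟩ ⟨h, ⟨c⟩⟩
    refine Prod.ext rfl ?_
    change postcomp h (postcomp g (cls a) + precomp f (cls b)) + precomp (compOne f g) (cls c) =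
      postcomp (compOne g h) (cls a) + precomp f (postcomp h (cls b) + precomp g (cls c))
    rw [map_add, map_add, add_assoc]
    rfl

/-- The morphism `f₁ + [f_ε]` of `Ŝ`. -/
def homMk {V W : SHat k} (f : HomOne V W) (e : Hom0 V W) : V ⟶ W := (f, cls e)

lemma homMk_surj {V W : SHat k} (φ : V ⟶ W) : ∃ f e, φ = homMk f e := by
  obtain ⟨f, ⟨e⟩⟩ := φ
  exact ⟨f, e, rfl⟩

lemma homMk_eq_iff {V W : SHat k} (f f' : HomOne V W) (e e' : Hom0 V W) :
    homMk f e = homMk f' e' ↔ f = f' ∧ ∃ h, delta V W h = e - e' := by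
  refine Prod.ext_iff.trans (and_congr Iff.rfl ?_)
  exact Submodule.Quotient.eq _

lemma homMk_comp {V W Z : SHat k} (f : HomOne V W) (e : Hom0 V W) (g : HomOne W Z)
    (e' : Hom0 W Z) :
    homMk f e ≫ homMk g e' =
      homMk (compOne f g) fun i => g.1 i ∘ₗ e i + e' i ∘ₗ f.1 i := rfl

lemma id_eq (V : SHat k) : 𝟙 V = homMk (idOne V) 0 := rfl

instance (V W : SHat k) : AddCommGroup (V ⟶ W) :=
  inferInstanceAs (AddCommGroup (HomOne V W × HomEps V W))

instance (V W : SHat k) : Module k (V ⟶ W) :=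
  inferInstanceAs (Module k (HomOne V W × HomEps V W))

lemma homMk_add {V W : SHat k} (f f' : HomOne V W) (e e' : Hom0 V W) :
    homMk f e + homMk f' e' = homMk (f + f') (e + e') := rfl

lemma homMk_smul {V W : SHat k} (c : k) (f : HomOne V W) (e : Hom0 V W) :
    c • homMk f e = homMk (c • f) (c • e) := rfl

lemma homMk_zero {V W : SHat k} : homMk 0 0 = (0 : V ⟶ W) := rfl

lemma homMk_congr {V W : SHat k} {f f' : HomOne V W} {e e' : Hom0 V W}
    (h : ∀ i, f.1 i = f'.1 i) (h' : ∀ i, e i = e' i) : homMk f e = homMk f' e' := by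
  obtain rfl : f = f' := Subtype.ext (funext h)
  obtain rfl : e = e' := funext h'
  rfl

instance : Preadditive (SHat k) where
  add_comp V W Z φ φ' ψ := by
    obtain ⟨f, e, rfl⟩ := homMk_surj φ
    obtain ⟨f', e', rfl⟩ := homMk_surj φ'
    obtain ⟨g, a, rfl⟩ := homMk_surj ψ
    simp only [homMk_add, homMk_comp]
    refine homMk_congr (fun i => LinearMap.comp_add _ _ _) (fun i => ?_)
    simp only [Pi.add_apply, Submodule.coe_add, LinearMap.comp_add]
    abel
  comp_add V W Z φ ψ ψ' := by
    obtain ⟨f, e, rfl⟩ := homMk_surj φ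
    obtain ⟨g, a, rfl⟩ := homMk_surj ψ
    obtain ⟨g', a', rfl⟩ := homMk_surj ψ'
    simp only [homMk_add, homMk_comp]
    refine homMk_congr (fun i => LinearMap.add_comp _ _ _) (fun i => ?_)
    simp only [Pi.add_apply, Submodule.coe_add, LinearMap.add_comp]
    abel

instance : Linear k (SHat k) where
  smul_comp V W Z c φ ψ := by
    obtain ⟨f, e, rfl⟩ := homMk_surj φ
    obtain ⟨g, a, rfl⟩ := homMk_surj ψ
    simp only [homMk_smul, homMk_comp]
    refine homMk_congr (fun i => LinearMap.comp_smul _ _ _) (fun i => ?_)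
    simp only [Pi.smul_apply, Submodule.coe_smul, LinearMap.comp_smul, smul_add]
  comp_smul V W Z φ c ψ := by
    obtain ⟨f, e, rfl⟩ := homMk_surj φ
    obtain ⟨g, a, rfl⟩ := homMk_surj ψ
    simp only [homMk_smul, homMk_comp]
    refine homMk_congr (fun i => LinearMap.smul_comp _ _ _) (fun i => ?_)
    simp only [Pi.smul_apply, Submodule.coe_smul, LinearMap.smul_comp, smul_add]

instance : HasZeroObject (SHat k) where
  zero := by
    let Z : SHat k := ⟨fun _ => ModuleCat.of k PUnit, fun _ _ _ => 0⟩
    refine ⟨Z, (IsZero.iff_id_eq_zero Z).2 ?_⟩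
    rw [id_eq, ← homMk_zero]
    exact homMk_congr (fun i => LinearMap.ext fun _ => rfl) (fun i => rfl)

/-! ### The shift -/

/-- The shifted sequence `V[n]`, with `V[n]^i = V^{i + n}` and maps multiplied by `(-1)^n`. -/
abbrev shiftObj (n : ℤ) (V : SHat k) : SHat k where
  X i := V.X (i + n)
  d i j h := n.negOnePow • V.d (i + n) (j + n) (by lia)

/-- The shift of a family of degree `0`. -/
def shift0 (n : ℤ) (V W : SHat k) : Hom0 V W →ₗ[k] Hom0 (shiftObj n V) (shiftObj n W) where
  toFun f i := f (i + n)
  map_add' _ _ := rfl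
  map_smul' _ _ := rfl

/-- The shift of a morphism of sequences. -/
def shiftOne (n : ℤ) {V W : SHat k} (f : HomOne V W) :
    HomOne (shiftObj n V) (shiftObj n W) :=
  ⟨shift0 n V W f.1, fun i j h => by
    have e := f.2 (i + n) (j + n) (by lia)
    change ((n.negOnePow : ℤ) • W.d _ _ _) ∘ₗ f.1 (i + n) =
      f.1 (j + n) ∘ₗ ((n.negOnePow : ℤ) • V.d _ _ _)
    exact (LinearMap.smul_comp _ _ _).trans
      ((congrArg (fun t => (n.negOnePow : ℤ) • t) e).trans (LinearMap.comp_smul _ _ _).symm)⟩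

lemma shift0_delta (n : ℤ) (V W : SHat k) (h : HomNeg V W) :
    delta (shiftObj n V) (shiftObj n W)
      (fun p => n.negOnePow • h ⟨(p.1.1 + n, p.1.2 + n), by have := p.2; lia⟩) =
      shift0 n V W (delta V W h) := by
  funext i
  rw [delta_apply _ _ _ (show i - 1 + 1 = i by lia) rfl]
  refine Eq.trans ?_ (delta_apply V W h (show i - 1 + n + 1 = i + n by lia)
    (show i + n + 1 = i + 1 + n by lia)).symm
  simp only [Units.smul_def, LinearMap.smul_comp, LinearMap.comp_smul, smul_smul]
  simp [← Units.val_mul]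

/-- The shift of a class of families of degree `0`. -/
def shiftEps (n : ℤ) (V W : SHat k) : HomEps V W →ₗ[k] HomEps (shiftObj n V) (shiftObj n W) :=
  Submodule.mapQ _ _ (shift0 n V W) (by
    rintro _ ⟨h, rfl⟩
    exact ⟨_, shift0_delta n V W h⟩)

/-- The shift functor by `n`, with `f[n]^i = f^{i + n}` for both components of a morphism. -/
@[simps obj]
def shiftF (k : Type u) [Field k] (n : ℤ) : SHat k ⥤ SHat k where
  obj V := shiftObj n V
  map {V W} φ := (shiftOne n φ.1, shiftEps n V W φ.2)
  map_id V := rfl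
  map_comp {V W Z} φ ψ := by
    obtain ⟨f, e, rfl⟩ := homMk_surj φ
    obtain ⟨g, a, rfl⟩ := homMk_surj ψ
    rfl

lemma shiftF_map_homMk (n : ℤ) {V W : SHat k} (f : HomOne V W) (e : Hom0 V W) :
    (shiftF k n).map (homMk f e) = homMk (shiftOne n f) (shift0 n V W e) := rfl

instance (n : ℤ) : (shiftF k n).Additive where
  map_add {V W φ ψ} := by
    obtain ⟨f, e, rfl⟩ := homMk_surj φ
    obtain ⟨g, a, rfl⟩ := homMk_surj ψ
    rfl

/-- Transport of degrees along an equality. -/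
def castX (V : SHat k) {i j : ℤ} (h : i = j) : V.X i →ₗ[k] V.X j :=
  h ▸ LinearMap.id

@[simp] lemma castX_rfl (V : SHat k) (i : ℤ) : V.castX (rfl : i = i) = LinearMap.id := rfl

@[simp] lemma castX_comp (V : SHat k) {i j l : ℤ} (h : i = j) (h' : j = l) :
    V.castX h' ∘ₗ V.castX h = V.castX (h.trans h') := by
  subst h h'; rfl

lemma d_castX (V : SHat k) {i j i' j' : ℤ} (h : i = i') (hj : j = j') (hij : i + 1 = j)
    (hij' : i' + 1 = j') :
    V.d i' j' hij' ∘ₗ V.castX h = V.castX hj ∘ₗ V.d i j hij := by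
  subst h hj; rfl

lemma hom0_castX {V W : SHat k} (f : Hom0 V W) {i j : ℤ} (h : i = j) :
    W.castX h ∘ₗ f i = f j ∘ₗ V.castX h := by
  subst h; rfl

lemma castX_shiftObj (n : ℤ) (V : SHat k) {i j : ℤ} (h : i = j) :
    (shiftObj n V).castX h = V.castX (show i + n = j + n by rw [h]) := by
  subst h; rfl

/-- The morphisms of `Ŝ` of the form `f₁ + [0]`. -/
abbrev ofOne {V W : SHat k} (f : HomOne V W) : V ⟶ W := homMk f 0

lemma ofOne_congr {V W : SHat k} {f g : HomOne V W} (h : ∀ i, f.1 i = g.1 i) :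
    ofOne f = ofOne g :=
  homMk_congr h fun _ => rfl

lemma ofOne_comp {V W Z : SHat k} (f : HomOne V W) (g : HomOne W Z) :
    ofOne f ≫ ofOne g = ofOne (compOne f g) :=
  homMk_congr (fun _ => rfl) fun i => by simp

lemma ofOne_comp_homMk {V W Z : SHat k} (f : HomOne V W) (g : HomOne W Z) (e : Hom0 W Z) :
    ofOne f ≫ homMk g e = homMk (compOne f g) fun i => e i ∘ₗ f.1 i :=
  homMk_congr (fun _ => rfl) fun i => by simp; rfl

lemma homMk_comp_ofOne {V W Z : SHat k} (f : HomOne V W) (e : Hom0 V W) (g : HomOne W Z) :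
    homMk f e ≫ ofOne g = homMk (compOne f g) fun i => g.1 i ∘ₗ e i :=
  homMk_congr (fun _ => rfl) fun i => by simp; rfl

/-- The transport `V[n] → V[m]` for `n = m`. -/
def shiftCongr (V : SHat k) {n m : ℤ} (h : n = m) : HomOne (shiftObj n V) (shiftObj m V) :=
  ⟨fun i => V.castX (by rw [h]), fun i j hij => by subst h; rfl⟩

/-- The transport `V[0] → V`. -/
def shiftZeroHom (V : SHat k) : HomOne (shiftObj 0 V) V :=
  ⟨fun i => V.castX (add_zero i), fun i j h => by
    refine (d_castX V (add_zero i) (add_zero j) (by lia) h).trans ?_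
    change _ = _ ∘ₗ ((0 : ℤ).negOnePow • V.d _ _ _)
    rw [Int.negOnePow_zero, one_smul]⟩

/-- The transport `V → V[0]`. -/
def shiftZeroInv (V : SHat k) : HomOne V (shiftObj 0 V) :=
  ⟨fun i => V.castX (add_zero i).symm, fun i j h => by
    refine Eq.trans ?_ (d_castX V (add_zero i).symm (add_zero j).symm h (by lia))
    change ((0 : ℤ).negOnePow • V.d _ _ _) ∘ₗ _ = _
    rw [Int.negOnePow_zero, one_smul]⟩

lemma shiftObj_shiftObj_d (V : SHat k) (n m i j : ℤ) (h : i + 1 = j) :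
    (shiftObj m (shiftObj n V)).d i j h =
      (n + m).negOnePow • V.d (i + m + n) (j + m + n) (by lia) := by
  change m.negOnePow • n.negOnePow • V.d _ _ _ = _
  rw [smul_smul, ← Int.negOnePow_add, add_comm m n]

/-- The transport `V[n + m] → V[n][m]`. -/
def shiftAddHom (V : SHat k) (n m : ℤ) :
    HomOne (shiftObj (n + m) V) (shiftObj m (shiftObj n V)) :=
  ⟨fun i => V.castX (show i + (n + m) = i + m + n by lia), fun i j h => by
    have := d_castX V (show i + (n + m) = i + m + n by lia)
      (show j + (n + m) = j + m + n by lia) (by lia) (by lia)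
    rw [shiftObj_shiftObj_d]
    simp only [Units.smul_def, LinearMap.smul_comp, LinearMap.comp_smul, this]⟩

/-- The transport `V[n][m] → V[n + m]`. -/
def shiftAddInv (V : SHat k) (n m : ℤ) :
    HomOne (shiftObj m (shiftObj n V)) (shiftObj (n + m) V) :=
  ⟨fun i => V.castX (show i + m + n = i + (n + m) by lia), fun i j h => by
    have := d_castX V (show i + m + n = i + (n + m) by lia)
      (show j + m + n = j + (n + m) by lia) (by lia) (by lia)
    rw [shiftObj_shiftObj_d]
    simp only [Units.smul_def, LinearMap.smul_comp, LinearMap.comp_smul, this]⟩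

/-- `V[n] ≅ V` for `n = 0`: the transport of degrees. -/
def shiftZeroIso (k : Type u) [Field k] : shiftF k 0 ≅ 𝟭 (SHat k) :=
  NatIso.ofComponents
    (fun V =>
      { hom := ofOne (shiftZeroHom V)
        inv := ofOne (shiftZeroInv V)
        hom_inv_id := (ofOne_comp _ _).trans (ofOne_congr fun i => V.castX_comp _ _)
        inv_hom_id := (ofOne_comp _ _).trans (ofOne_congr fun i => V.castX_comp _ _) })
    (fun {V W} φ => by
      obtain ⟨f, e, rfl⟩ := homMk_surj φ
      refine (homMk_comp_ofOne _ _ _).trans (Eq.trans ?_ (ofOne_comp_homMk _ _ _).symm)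
      exact homMk_congr (fun i => hom0_castX f.1 _) (fun i => hom0_castX e _))

/-- `V[n + m] ≅ V[n][m]`: the transport of degrees. -/
def shiftAddIso (k : Type u) [Field k] (n m : ℤ) :
    shiftF k (n + m) ≅ shiftF k n ⋙ shiftF k m :=
  NatIso.ofComponents
    (fun V =>
      { hom := ofOne (shiftAddHom V n m)
        inv := ofOne (shiftAddInv V n m)
        hom_inv_id := (ofOne_comp _ _).trans (ofOne_congr fun i => V.castX_comp _ _)
        inv_hom_id := (ofOne_comp _ _).trans (ofOne_congr fun i => V.castX_comp _ _) })
    (fun {V W} φ => by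
      obtain ⟨f, e, rfl⟩ := homMk_surj φ
      refine (homMk_comp_ofOne _ _ _).trans (Eq.trans ?_ (ofOne_comp_homMk _ _ _).symm)
      exact homMk_congr (fun i => hom0_castX f.1 _) (fun i => hom0_castX e _))

lemma eqToHom_shift (V : SHat k) {n m : ℤ} (h : n = m) (h' : shiftObj n V = shiftObj m V) :
    eqToHom h' = ofOne (shiftCongr V h) := by
  subst h; rfl

lemma shiftAdd_assoc (a b c : ℤ) (V : SHat k) :
    ofOne (shiftAddHom V (a + b) c) ≫ ofOne (shiftOne c (shiftAddHom V a b)) =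
      ofOne (shiftCongr V (add_assoc a b c)) ≫ ofOne (shiftAddHom V a (b + c)) ≫
        ofOne (shiftAddHom (shiftObj a V) b c) := by
  simp only [ofOne_comp]
  refine ofOne_congr fun i => (V.castX_comp _ _).trans (Eq.symm ?_)
  have e : (shiftObj a V).castX (show i + (b + c) = i + c + b by lia) =
      V.castX (show i + (b + c) + a = i + c + b + a by lia) := castX_shiftObj a V _
  change ((shiftObj a V).castX _ ∘ₗ V.castX _) ∘ₗ V.castX _ = _
  rw [e, V.castX_comp, V.castX_comp]

lemma shiftAdd_zero_add (n : ℤ) (V : SHat k) :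
    ofOne (shiftAddHom V 0 n) =
      ofOne (shiftCongr V (zero_add n)) ≫ ofOne (shiftOne n (shiftZeroInv V)) := by
  rw [ofOne_comp]
  exact ofOne_congr fun i => (V.castX_comp _ _).symm

lemma shiftAdd_add_zero (n : ℤ) (V : SHat k) :
    ofOne (shiftAddHom V n 0) =
      ofOne (shiftCongr V (add_zero n)) ≫ ofOne (shiftZeroInv (shiftObj n V)) := by
  rw [ofOne_comp]
  refine ofOne_congr fun i => ?_
  have e : (shiftObj n V).castX (show i = i + 0 by lia) =
      V.castX (show i + n = i + 0 + n by lia) := castX_shiftObj n V _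
  change _ = (shiftObj n V).castX _ ∘ₗ V.castX _
  rw [e, V.castX_comp]
  rfl

lemma shiftAddIso_add_zero (n : ℤ) (V : SHat k)
    (h : (shiftF k (n + 0)).obj V = (shiftF k n).obj V) :
    (shiftAddIso k n 0).hom.app V =
      eqToHom h ≫ (shiftZeroIso k).inv.app ((shiftF k n).obj V) := by
  have e : eqToHom h = ofOne (shiftCongr V (add_zero n)) := eqToHom_shift V (add_zero n) h
  rw [e]
  exact shiftAdd_add_zero n V

lemma shiftAddIso_zero_add (n : ℤ) (V : SHat k)
    (h : (shiftF k (0 + n)).obj V = (shiftF k n).obj V) :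
    (shiftAddIso k 0 n).hom.app V =
      eqToHom h ≫ (shiftF k n).map ((shiftZeroIso k).inv.app V) := by
  have e : eqToHom h = ofOne (shiftCongr V (zero_add n)) := eqToHom_shift V (zero_add n) h
  rw [e]
  exact shiftAdd_zero_add n V

lemma shiftAddIso_assoc (a b c : ℤ) (V : SHat k)
    (h : (shiftF k (a + b + c)).obj V = (shiftF k (a + (b + c))).obj V) :
    (shiftAddIso k (a + b) c).hom.app V ≫ (shiftF k c).map ((shiftAddIso k a b).hom.app V) =
      eqToHom h ≫ (shiftAddIso k a (b + c)).hom.app V ≫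
        (shiftAddIso k b c).hom.app ((shiftF k a).obj V) := by
  have e : eqToHom h = ofOne (shiftCongr V (add_assoc a b c)) :=
    eqToHom_shift V (add_assoc a b c) h
  rw [e]
  exact shiftAdd_assoc a b c V

/-- The shift functors on `Ŝ` with their coherent isomorphisms. -/
def shiftCore (k : Type u) [Field k] : ShiftMkCore (SHat k) ℤ :=
  .mk (shiftF k) (shiftZeroIso k) (shiftAddIso k)
    (by intro a b c V; rw [shiftAddIso_assoc])
    (by intro n V; rw [shiftAddIso_zero_add])
    (by intro n V; rw [shiftAddIso_add_zero])

instance : HasShift (SHat k) ℤ := hasShiftMk _ _ (shiftCore k)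

instance (n : ℤ) : (shiftFunctor (SHat k) n).Additive :=
  inferInstanceAs (shiftF k n).Additive

/-! ### Comparison with complexes of free modules over the dual numbers -/

/-- The `A`-linear map `f₁ + a f_a` from `A ⊗ V` to `A ⊗ W`. -/
def extMap {A : Type u} [CommRing A] [Algebra k A] (a : A) {V W : Type u} [AddCommGroup V]
    [Module k V] [AddCommGroup W] [Module k W] (f e : V →ₗ[k] W) : A ⊗[k] V →ₗ[A] A ⊗[k] W :=
  f.baseChange A + a • e.baseChange A

section extMap

variable {A : Type u} [CommRing A] [Algebra k A] (a : A) {V W Z : Type u} [AddCommGroup V]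
  [Module k V] [AddCommGroup W] [Module k W] [AddCommGroup Z] [Module k Z]

lemma extMap_comp (ha : a * a = 0) (f e : V →ₗ[k] W) (g b : W →ₗ[k] Z) :
    extMap a g b ∘ₗ extMap a f e = extMap a (g ∘ₗ f) (g ∘ₗ e + b ∘ₗ f) := by
  simp only [extMap, LinearMap.add_comp, LinearMap.comp_add, LinearMap.smul_comp,
    LinearMap.comp_smul, smul_smul, ha, zero_smul, add_zero,
    LinearMap.baseChange_comp, LinearMap.baseChange_add, smul_add]
  abel

lemma extMap_id : extMap a (LinearMap.id : V →ₗ[k] V) 0 = LinearMap.id := by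
  simp [extMap]

lemma extMap_zero : extMap a (0 : V →ₗ[k] W) 0 = 0 := by
  simp [extMap]

lemma extMap_homotopy {U Y : Type u} [AddCommGroup U] [Module k U] [AddCommGroup Y] [Module k Y]
    (f e e' : V →ₗ[k] W) (d : V →ₗ[k] U) (h : U →ₗ[k] W) (h' : V →ₗ[k] Y) (d' : Y →ₗ[k] W)
    (he : d' ∘ₗ h' + h ∘ₗ d = e - e') :
    extMap a f e = extMap a h 0 ∘ₗ extMap a 0 d + extMap a 0 d' ∘ₗ extMap a h' 0 +
      extMap a f e' := by
  obtain rfl : e = e' + (d' ∘ₗ h' + h ∘ₗ d) := by rw [he]; abel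
  simp only [extMap, LinearMap.baseChange_add, LinearMap.baseChange_comp, LinearMap.comp_smul,
    LinearMap.smul_comp, smul_add, LinearMap.baseChange_zero, smul_zero, add_zero, zero_add]
  abel

end extMap

/-- The morphism `f₁ + ε f_ε` of free `k[ε]`-modules from `k[ε] ⊗ V` to `k[ε] ⊗ W`. -/
noncomputable abbrev extHom {V W : ModuleCat.{u} k} (f e : V →ₗ[k] W) :
    ModuleCat.of (DualNumber k) (DualNumber k ⊗[k] V) ⟶
      ModuleCat.of (DualNumber k) (DualNumber k ⊗[k] W) :=
  ModuleCat.ofHom (extMap (DualNumber.eps : DualNumber k) f e)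

lemma extHom_comp {V W Z : ModuleCat.{u} k} (f e : V →ₗ[k] W) (g b : W →ₗ[k] Z) :
    extHom f e ≫ extHom g b = extHom (g ∘ₗ f) (g ∘ₗ e + b ∘ₗ f) :=
  congrArg ModuleCat.ofHom (extMap_comp _ DualNumber.eps_mul_eps _ _ _ _)

lemma extHom_id (V : ModuleCat.{u} k) : extHom (LinearMap.id : V →ₗ[k] V) 0 = 𝟙 _ :=
  congrArg ModuleCat.ofHom (extMap_id _)

lemma extHom_zero (V W : ModuleCat.{u} k) : extHom (0 : V →ₗ[k] W) 0 = 0 :=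
  congrArg ModuleCat.ofHom (extMap_zero _)

lemma extHom_zero_left {V W : ModuleCat.{u} k} (f : V →ₗ[k] W) :
    extHom 0 f = ModuleCat.ofHom
      ((DualNumber.eps : DualNumber k) • f.baseChange (DualNumber k)) := by
  simp only [extHom, extMap, LinearMap.baseChange_zero, zero_add]

/-- The complex of free `k[ε]`-modules attached to a sequence `V`: it is `k[ε] ⊗ V^i` in degree
`i`, and its differential is `ε d_V`. -/
noncomputable def toComplex (V : SHat k) : CochainComplex (ModuleCat.{u} (DualNumber k)) ℤ where
  X i := ModuleCat.of (DualNumber k) (DualNumber k ⊗[k] V.X i)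
  d i j := if h : i + 1 = j then extHom 0 (V.d i j h) else 0
  shape i j h := dif_neg h
  d_comp_d' i j l hij hjl := by
    rw [dif_pos (show i + 1 = j from hij), dif_pos (show j + 1 = l from hjl), extHom_comp]
    simp only [LinearMap.zero_comp, LinearMap.comp_zero, add_zero, extHom_zero]

lemma toComplex_d (V : SHat k) {i j : ℤ} (h : i + 1 = j) :
    V.toComplex.d i j = extHom 0 (V.d i j h) :=
  dif_pos h

/-- The morphism of complexes `f₁ + ε f_ε`. -/
noncomputable def toComplexMap {V W : SHat k} (f : HomOne V W) (e : Hom0 V W) :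
    V.toComplex ⟶ W.toComplex where
  f i := extHom (f.1 i) (e i)
  comm' i j hij := by
    have h : i + 1 = j := hij
    rw [toComplex_d _ h, toComplex_d _ h]
    refine (extHom_comp _ _ _ _).trans (Eq.trans ?_ (extHom_comp _ _ _ _).symm)
    rw [f.2 i j h]
    simp only [LinearMap.zero_comp, LinearMap.comp_zero, add_zero, zero_add]

/-- A family of degree `-1` seen as a family of maps between the terms of the complexes. -/
noncomputable def extNeg {V W : SHat k} (h : HomNeg V W) (i j : ℤ) :
    V.toComplex.X i ⟶ W.toComplex.X j :=
  if hij : j + 1 = i then extHom (h ⟨(i, j), hij⟩) 0 else 0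

lemma extNeg_eq {V W : SHat k} (h : HomNeg V W) {i j : ℤ} (hij : j + 1 = i) :
    extNeg h i j = extHom (h ⟨(i, j), hij⟩) 0 :=
  dif_pos hij

/-- Families of degree `0` with the same class give homotopic morphisms of complexes. -/
lemma homotopic_of_delta {V W : SHat k} (f : HomOne V W) (e e' : Hom0 V W) (h : HomNeg V W)
    (he : delta V W h = e - e') :
    homotopic _ _ (toComplexMap f e) (toComplexMap f e') := by
  refine ⟨{ hom := extNeg h
            zero := fun i j hij => dif_neg hij
            comm := fun i => ?_ }⟩
  rw [dNext_eq _ (show (ComplexShape.up ℤ).Rel i (i + 1) from rfl),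
    prevD_eq _ (show (ComplexShape.up ℤ).Rel (i - 1) i from sub_add_cancel i 1),
    toComplex_d V rfl, toComplex_d W (sub_add_cancel i 1), extNeg_eq h rfl,
    extNeg_eq h (sub_add_cancel i 1)]
  exact congrArg ModuleCat.ofHom (extMap_homotopy _ _ _ _ _ _ _ _
    ((delta_apply V W h (sub_add_cancel i 1) rfl).symm.trans (congrFun he i)))

/-- The homotopy category `K(Mod k[ε])` of (unbounded) complexes of `k[ε]`-modules. -/
abbrev K (k : Type u) [Field k] := HomotopyCategory (ModuleCat.{u} (DualNumber k)) (.up ℤ)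

/-- The functor from `Ŝ` to `K(Mod k[ε])` sending `V` to the complex `k[ε] ⊗ V^i` with differential
`ε d_V`, and `f₁ + [f_ε]` to the homotopy class of `f₁ + ε f_ε`. -/
noncomputable def toK (k : Type u) [Field k] : SHat k ⥤ K k where
  obj V := (HomotopyCategory.quotient _ _).obj V.toComplex
  map {V W} φ := Quotient.liftOn φ.2
    (fun e => (HomotopyCategory.quotient _ _).map (toComplexMap φ.1 e))
    (fun e e' hee' => by
      obtain ⟨h, hh⟩ := (Submodule.quotientRel_def _).1 hee'
      obtain ⟨H⟩ := homotopic_of_delta φ.1 e e' h hh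
      exact HomotopyCategory.eq_of_homotopy _ _ H)
  map_id V := by
    refine Eq.trans ?_ ((HomotopyCategory.quotient _ _).map_id _)
    refine congrArg (HomotopyCategory.quotient _ _).map ?_
    ext i : 1
    exact extHom_id _
  map_comp φ ψ := by
    obtain ⟨f, e, rfl⟩ := homMk_surj φ
    obtain ⟨g, a, rfl⟩ := homMk_surj ψ
    refine Eq.trans ?_ ((HomotopyCategory.quotient _ _).map_comp _ _)
    refine congrArg (HomotopyCategory.quotient _ _).map ?_
    ext i : 1
    exact (extHom_comp _ _ _ _).symm

lemma toK_map_homMk {V W : SHat k} (f : HomOne V W) (e : Hom0 V W) :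
    (toK k).map (homMk f e) = (HomotopyCategory.quotient _ _).map (toComplexMap f e) := rfl

/-! ### Compatibility with the shifts -/

lemma extHom_units_smul {V W : ModuleCat.{u} k} (n : ℤˣ) (f : V →ₗ[k] W) :
    extHom 0 (n • f) = n • extHom 0 f := by
  rcases Int.units_eq_one_or n with rfl | rfl
  · rw [one_smul, one_smul]
  · rw [Units.neg_smul, one_smul, Units.neg_smul, one_smul]
    ext x
    simp [extHom, extMap, LinearMap.baseChange_neg]

/-- The complex attached to `V[n]` is the `n`-th shift of the complex attached to `V`. -/
noncomputable def toComplexShift (n : ℤ) (V : SHat k) :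
    (shiftObj n V).toComplex ≅ V.toComplex⟦n⟧ :=
  HomologicalComplex.Hom.isoOfComponents (fun _ => Iso.refl _) (by
    intro i j hij
    have h : i + 1 = j := hij
    rw [toComplex_d _ h, CochainComplex.shiftFunctor_obj_d',
      toComplex_d V (show i + n + 1 = j + n by lia)]
    refine (Category.id_comp _).trans (Eq.trans ?_ (Category.comp_id _).symm)
    exact (extHom_units_smul _ _).symm)

lemma toComplexShift_hom_f (n : ℤ) (V : SHat k) (i : ℤ) :
    (toComplexShift n V).hom.f i = 𝟙 _ := rfl

lemma XIsoOfEq_toComplex (V : SHat k) {i j : ℤ} (h : i = j) :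
    (V.toComplex.XIsoOfEq h).hom = extHom (V.castX h) 0 := by
  subst h
  exact (extHom_id _).symm

lemma toComplexShift_natural (n : ℤ) {V W : SHat k} (f : HomOne V W) (e : Hom0 V W) :
    toComplexMap (shiftOne n f) (shift0 n V W e) ≫ (toComplexShift n W).hom =
      (toComplexShift n V).hom ≫ (toComplexMap f e)⟦n⟧' := by
  ext i : 1
  exact (Category.comp_id _).trans (Category.id_comp _).symm

lemma toComplexShift_zero (V : SHat k) :
    (toComplexShift 0 V).hom ≫ (shiftFunctorZero (CochainComplex _ ℤ) ℤ).hom.app V.toComplex =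
      toComplexMap (shiftZeroHom V) 0 := by
  ext i : 1
  rw [HomologicalComplex.comp_f, CochainComplex.shiftFunctorZero_hom_app_f]
  exact (Category.id_comp _).trans (XIsoOfEq_toComplex V _)

lemma toComplexShift_add (V : SHat k) (a b : ℤ) :
    (toComplexShift (a + b) V).hom ≫
        (shiftFunctorAdd (CochainComplex _ ℤ) a b).hom.app V.toComplex =
      toComplexMap (shiftAddHom V a b) 0 ≫ (toComplexShift b (shiftObj a V)).hom ≫
        (toComplexShift a V).hom⟦b⟧' := by
  ext i : 1
  rw [HomologicalComplex.comp_f, HomologicalComplex.comp_f, HomologicalComplex.comp_f,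
    CochainComplex.shiftFunctorAdd_hom_app_f]
  refine (Category.id_comp _).trans ((XIsoOfEq_toComplex V _).trans (Eq.symm ?_))
  refine Eq.trans (congrArg (_ ≫ ·) (Category.id_comp _)) ?_
  exact Category.comp_id _

/-- The isomorphisms `toK (V[n]) ≅ (toK V)[n]`. -/
noncomputable def toKShiftIso (k : Type u) [Field k] (n : ℤ) :
    shiftFunctor (SHat k) n ⋙ toK k ≅ toK k ⋙ shiftFunctor (K k) n :=
  NatIso.ofComponents
    (fun V => (HomotopyCategory.quotient _ _).mapIso (toComplexShift n V) ≪≫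
      ((HomotopyCategory.quotient _ _).commShiftIso n).app V.toComplex)
    (by
      intro V W φ
      obtain ⟨f, e, rfl⟩ := homMk_surj φ
      have h1 := congrArg (HomotopyCategory.quotient _ _).map (toComplexShift_natural n f e)
      have h2 := ((HomotopyCategory.quotient (ModuleCat.{u} (DualNumber k))
        (.up ℤ)).commShiftIso n).hom.naturality (toComplexMap f e)
      simp only [Functor.map_comp] at h1
      change (HomotopyCategory.quotient _ _).map (toComplexMap (shiftOne n f) (shift0 n V W e)) ≫
        (HomotopyCategory.quotient _ _).map (toComplexShift n W).hom ≫ _ =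
        ((HomotopyCategory.quotient _ _).map (toComplexShift n V).hom ≫ _) ≫ _
      rw [reassoc_of% h1, Category.assoc]
      exact congrArg (_ ≫ ·) h2)

lemma toKShiftIso_hom_app (n : ℤ) (V : SHat k) :
    (toKShiftIso k n).hom.app V =
      (HomotopyCategory.quotient _ _).map (toComplexShift n V).hom ≫
        ((HomotopyCategory.quotient _ _).commShiftIso n).hom.app V.toComplex := rfl

lemma toK_map_shiftZero (V : SHat k) :
    (toK k).map ((shiftFunctorZero (SHat k) ℤ).hom.app V) =
      (HomotopyCategory.quotient _ _).map (toComplexMap (shiftZeroHom V) 0) := rfl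

lemma toK_map_shiftAdd (V : SHat k) (a b : ℤ) :
    (toK k).map ((shiftFunctorAdd (SHat k) a b).hom.app V) =
      (HomotopyCategory.quotient _ _).map (toComplexMap (shiftAddHom V a b) 0) := rfl

lemma commShift_aux_zero {C D : Type*} [Category C] [Category D] [HasShift C ℤ] [HasShift D ℤ]
    (Q : C ⥤ D) [Q.CommShift ℤ] {X Y : C} (c : Y ⟶ X⟦(0 : ℤ)⟧) (z : Y ⟶ X)
    (h : c ≫ (shiftFunctorZero C ℤ).hom.app X = z) :
    Q.map c ≫ (Q.commShiftIso (0 : ℤ)).hom.app X =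
      Q.map z ≫ (shiftFunctorZero D ℤ).inv.app (Q.obj X) := by
  rw [← h, Functor.commShiftIso_zero, Functor.CommShift.isoZero_hom_app, Functor.map_comp,
    Category.assoc]

lemma commShift_aux_add {C D : Type*} [Category C] [Category D] [HasShift C ℤ] [HasShift D ℤ]
    (Q : C ⥤ D) [Q.CommShift ℤ] {X Y Y' Z : C} (a b : ℤ) (c : Y ⟶ X⟦a + b⟧) (m : Y ⟶ Y')
    (cb : Y' ⟶ Z⟦b⟧) (ca : Z ⟶ X⟦a⟧)
    (h : c ≫ (shiftFunctorAdd C a b).hom.app X = m ≫ cb ≫ ca⟦b⟧') :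
    Q.map c ≫ (Q.commShiftIso (a + b)).hom.app X =
      Q.map m ≫ (Q.map cb ≫ (Q.commShiftIso b).hom.app Z) ≫
        (Q.map ca ≫ (Q.commShiftIso a).hom.app X)⟦b⟧' ≫
          (shiftFunctorAdd D a b).inv.app (Q.obj X) := by
  rw [Functor.commShiftIso_add, Functor.CommShift.isoAdd_hom_app, ← Functor.map_comp_assoc, h]
  simp

lemma toKShiftIso_zero (k : Type u) [Field k] :
    toKShiftIso k 0 = Functor.CommShift.isoZero (toK k) ℤ := by
  ext V
  rw [Functor.CommShift.isoZero_hom_app]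
  exact commShift_aux_zero (HomotopyCategory.quotient _ _) _ _ (toComplexShift_zero V)

lemma toKShiftIso_add (k : Type u) [Field k] (a b : ℤ) :
    toKShiftIso k (a + b) =
      Functor.CommShift.isoAdd (toKShiftIso k a) (toKShiftIso k b) := by
  ext V
  rw [Functor.CommShift.isoAdd_hom_app]
  exact commShift_aux_add (HomotopyCategory.quotient _ _) a b _ _ _ _ (toComplexShift_add V a b)

noncomputable instance : (toK k).CommShift ℤ where
  commShiftIso := toKShiftIso k
  commShiftIso_zero := toKShiftIso_zero k
  commShiftIso_add := toKShiftIso_add k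

/-! ### The subcategories -/

/-- The full subcategory `K_m` of `K(Mod k[ε])` of the minimal complexes: the complexes `M` of free
modules such that each differential `M^i → M^{i + 1}` is `ε` times a `k[ε]`-linear map. -/
def minimal (k : Type u) [Field k] : ObjectProperty (K k) := fun M =>
  (∀ i : ℤ, Module.Free (DualNumber k) (M.as.X i)) ∧
    ∀ i : ℤ, ∃ g : M.as.X i →ₗ[DualNumber k] M.as.X (i + 1),
      M.as.d i (i + 1) = ModuleCat.ofHom ((DualNumber.eps : DualNumber k) • g)

lemma minimal_toK (V : SHat k) : minimal k ((toK k).obj V) :=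
  ⟨fun i => inferInstanceAs (Module.Free (DualNumber k) (DualNumber k ⊗[k] V.X i)),
    fun i => ⟨(V.d i (i + 1) rfl).baseChange (DualNumber k),
      (toComplex_d V rfl).trans (extHom_zero_left _)⟩⟩

/-- The functor `Ŝ → K_m` obtained from `toK`. -/
noncomputable def toMinimal (k : Type u) [Field k] : SHat k ⥤ (minimal k).FullSubcategory :=
  (minimal k).lift (toK k) minimal_toK

noncomputable instance [(minimal k).IsStableUnderShift ℤ] : (toMinimal k).CommShift ℤ :=
  inferInstanceAs (((minimal k).lift (toK k) minimal_toK).CommShift ℤ)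

/-- `Ŝ_a`: the sequences whose complex is acyclic. -/
def acyclic (k : Type u) [Field k] : ObjectProperty (SHat k) :=
  (HomotopyCategory.subcategoryAcyclic (ModuleCat.{u} (DualNumber k))).inverseImage (toK k)

/-- `Ŝ_p`: the sequences whose complex is h-projective, that is, lies in the left orthogonal in
`K(Mod k[ε])` of the acyclic complexes. -/
def hproj (k : Type u) [Field k] : ObjectProperty (SHat k) :=
  (HomotopyCategory.subcategoryAcyclic
    (ModuleCat.{u} (DualNumber k))).leftOrthogonal.inverseImage (toK k)

end SHat

open Pretriangulated in
/-- `C = ⟨A, B⟩` is a semiorthogonal decomposition: `A` and `B` are strictly full triangulated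
subcategories, there is no nonzero morphism from an object of `B` to an object of `A`, and every
object `X` fits in a distinguished triangle `b → X → a → b[1]` with `b` in `B` and `a` in `A`. -/
structure IsSemiorthogonalDecomposition {C : Type*} [Category C] [Preadditive C] [HasZeroObject C]
    [HasShift C ℤ] [∀ n : ℤ, (shiftFunctor C n).Additive] [Pretriangulated C]
    (A B : ObjectProperty C) : Prop where
  isoClosed_left : A.IsClosedUnderIsomorphisms
  isoClosed_right : B.IsClosedUnderIsomorphisms
  triangulated_left : A.IsTriangulated
  triangulated_right : B.IsTriangulated
  hom_eq_zero : ∀ ⦃X Y : C⦄ (f : X ⟶ Y), B X → A Y → f = 0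
  exists_triangle : ∀ X : C, ∃ (b a : C) (f : b ⟶ X) (g : X ⟶ a) (h : a ⟶ b⟦(1 : ℤ)⟧),
    B b ∧ A a ∧ Triangle.mk f g h ∈ distTriang C

/-!
Write `ε` for the class of `t`, so that `k[ε] ⊗ V = V ⊕ ε V`.

A `k[ε]`-linear map `k[ε] ⊗ V → k[ε] ⊗ W` is the same thing as a sum `f + ε e` of two `k`-linear
maps `V → W` (`SHat.exists_extHom`). Between complexes of sequences, the sums commuting with the
differentials `ε d` are those for which `f` is a morphism of sequences, and the boundary of a
homotopy `a + ε b` is `ε (d a + a d)`. Hence the functor `Φ` is fully faithful; as free modules are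
extended from vector spaces, it is an equivalence onto the minimal complexes.

A complex of free modules has the form `k[ε] ⊗ V` with a differential `d₀ + ε d`. Since `k` is a
field, `(V, d₀)` contracts onto its cohomology `H`. The homological perturbation lemma transports
this contraction to `k[ε] ⊗ V`, all series stopping in `ε`-degree `1`, and shows that the complex is
homotopy equivalent to `k[ε] ⊗ H` with the differential `ε H(d)`, which is minimal
(`FreeComplex.Splitting.homotopyEquiv`). So the closure under isomorphism of the minimal complexes
consists of all complexes of free modules. It is stable under mapping cones, thus triangulated, and
the triangulated structure is carried over to `Ŝ` along `Φ` (`inducedPretriangulated`).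

Call a sequence locally nilpotent if each element is killed by a composition of consecutive maps.
The complex of such a sequence is h-projective (`SHat.LocallyNilpotent.isKProjective`): a
null-homotopy `s` of a morphism `φ` to an acyclic complex is found by choosing a `k`-linear section
`σ` of the differential on the cocycles, and solving the equation `s = σ (φ - ε s d)` by iteration,
which is a finite process on each element. On the other hand, the bar construction resolves any
complex `M` of modules by a complex `k[ε] ⊗ V` whose differential `d₀ + ε d` has a locally nilpotent
component `d`, namely a truncation of finitely supported families. The minimal model inherits the
local nilpotence, so every `M` receives, from the complex of a locally nilpotent sequence, a
morphism with an acyclic cone (`SHat.exists_locallyNilpotent_resolution`). For `M = Φ(X)` this is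
the triangle of the semiorthogonal decomposition. For general `M` it says that the functor from
`Ŝ_p` to the derived category is essentially surjective; it is fully faithful because morphisms out
of an h-projective complex are the same in the homotopy category and in the derived category.
-/

/-! ### Linear maps between extended modules over the dual numbers -/

namespace SHat

section Extended

variable {k : Type u} [Field k]

local notation "ε" => (DualNumber.eps : DualNumber k)

section

variable (V : Type u) [AddCommGroup V] [Module k V]

/-- The component `v` of an element `1 ⊗ v + ε ⊗ w` of `k[ε] ⊗ V`. -/
noncomputable def re : DualNumber k ⊗[k] V →ₗ[k] V :=
  (TensorProduct.lid k V).toLinearMap ∘ₗ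
    LinearMap.rTensor V (TrivSqZeroExt.fstHom k k k).toLinearMap

/-- The component `w` of an element `1 ⊗ v + ε ⊗ w` of `k[ε] ⊗ V`. -/
noncomputable def im : DualNumber k ⊗[k] V →ₗ[k] V :=
  (TensorProduct.lid k V).toLinearMap ∘ₗ LinearMap.rTensor V (TrivSqZeroExt.sndHom k k)

variable {V}

@[simp] lemma re_tmul (a : DualNumber k) (v : V) : re V (a ⊗ₜ[k] v) = a.fst • v := by
  simp [re]

@[simp] lemma im_tmul (a : DualNumber k) (v : V) : im V (a ⊗ₜ[k] v) = a.snd • v := by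
  simp [im]

lemma one_tmul_re_add_eps_tmul_im (x : DualNumber k ⊗[k] V) :
    (1 : DualNumber k) ⊗ₜ[k] re V x + ε ⊗ₜ[k] im V x = x := by
  induction x with
  | zero => simp
  | add x y hx hy =>
    rw [map_add, map_add, TensorProduct.tmul_add, TensorProduct.tmul_add, add_add_add_comm, hx, hy]
  | tmul a v =>
    rw [re_tmul, im_tmul, ← TensorProduct.smul_tmul, ← TensorProduct.smul_tmul,
      ← TensorProduct.add_tmul]
    congr 1
    ext <;> simp

lemma dualNumber_tensor_ext {x y : DualNumber k ⊗[k] V} (h₁ : re V x = re V y)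
    (h₂ : im V x = im V y) : x = y := by
  rw [← one_tmul_re_add_eps_tmul_im x, h₁, h₂, one_tmul_re_add_eps_tmul_im]

end

variable {V W : Type u} [AddCommGroup V] [Module k V] [AddCommGroup W] [Module k W]

lemma re_extMap (f e : V →ₗ[k] W) (x : DualNumber k ⊗[k] V) :
    re W (extMap ε f e x) = f (re V x) := by
  rw [← one_tmul_re_add_eps_tmul_im x]
  simp [extMap, TensorProduct.smul_tmul']

lemma im_extMap (f e : V →ₗ[k] W) (x : DualNumber k ⊗[k] V) :
    im W (extMap ε f e x) = f (im V x) + e (re V x) := by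
  rw [← one_tmul_re_add_eps_tmul_im x]
  simp [extMap, TensorProduct.smul_tmul']

lemma extMap_injective {f f' e e' : V →ₗ[k] W} (h : extMap ε f e = extMap ε f' e') :
    f = f' ∧ e = e' := by
  constructor <;> ext v
  · simpa [re_extMap] using congrArg (fun F => re W (F (1 ⊗ₜ v))) h
  · simpa [im_extMap] using congrArg (fun F => im W (F (1 ⊗ₜ v))) h

/-- Every `k[ε]`-linear map between extended modules is of the form `f + ε e`. -/
lemma exists_extMap (F : DualNumber k ⊗[k] V →ₗ[DualNumber k] DualNumber k ⊗[k] W) :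
    ∃ f e : V →ₗ[k] W, F = extMap ε f e := by
  let ι : V →ₗ[k] DualNumber k ⊗[k] V := TensorProduct.mk k (DualNumber k) V 1
  refine ⟨re W ∘ₗ F.restrictScalars k ∘ₗ ι, im W ∘ₗ F.restrictScalars k ∘ₗ ι, ?_⟩
  refine TensorProduct.AlgebraTensorModule.curry_injective ?_
  ext v
  refine dualNumber_tensor_ext ?_ ?_
  · simp [re_extMap, ι]
  · simp [im_extMap, ι]

lemma exists_extHom {V W : ModuleCat.{u} k}
    (F : ModuleCat.of (DualNumber k) (DualNumber k ⊗[k] V) ⟶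
      ModuleCat.of (DualNumber k) (DualNumber k ⊗[k] W)) :
    ∃ f e : V →ₗ[k] W, F = extHom f e := by
  obtain ⟨f, e, h⟩ := exists_extMap F.hom
  exact ⟨f, e, ModuleCat.hom_ext h⟩

lemma extHom_injective {V W : ModuleCat.{u} k} {f f' e e' : V →ₗ[k] W}
    (h : extHom f e = extHom f' e') : f = f' ∧ e = e' :=
  extMap_injective (congrArg ModuleCat.Hom.hom h)

lemma extHom_add {V W : ModuleCat.{u} k} (f f' e e' : V →ₗ[k] W) :
    extHom f e + extHom f' e' = extHom (f + f') (e + e') := by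
  ext1
  change extMap ε f e + extMap ε f' e' = extMap ε (f + f') (e + e')
  simp only [extMap, LinearMap.baseChange_add, smul_add]
  abel

lemma extHom_smul_eps {V W : ModuleCat.{u} k} (f e : V →ₗ[k] W) :
    ModuleCat.ofHom (ε • extMap ε f e) = extHom 0 f := by
  ext1
  simp [extMap, smul_smul]

/-- A free `k[ε]`-module is extended from a vector space. -/
lemma exists_iso_extended (M : ModuleCat.{u} (DualNumber k)) [Module.Free (DualNumber k) M] :
    ∃ V : ModuleCat.{u} k,
      Nonempty (M ≅ ModuleCat.of (DualNumber k) (DualNumber k ⊗[k] V)) := by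
  let b := Module.Free.chooseBasis (DualNumber k) M
  let c := Algebra.TensorProduct.basis (DualNumber k)
    (Finsupp.basisSingleOne (R := k) (ι := Module.Free.ChooseBasisIndex (DualNumber k) M))
  exact ⟨ModuleCat.of k (Module.Free.ChooseBasisIndex (DualNumber k) M →₀ k),
    ⟨(b.equiv c (Equiv.refl _)).toModuleIso⟩⟩

lemma extMap_zero_one_tmul (e : V →ₗ[k] W) (v : V) :
    extMap ε 0 e (1 ⊗ₜ v) = ε • (1 : DualNumber k) ⊗ₜ[k] e v := by
  simp [extMap]

/-- A `k[ε]`-linear map from `k[ε] ⊗ V` is determined by its restriction to `1 ⊗ V`. -/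
lemma ext_one_tmul {N : Type*} [AddCommGroup N] [Module (DualNumber k) N]
    {F G : DualNumber k ⊗[k] V →ₗ[DualNumber k] N}
    (h : ∀ v, F (1 ⊗ₜ v) = G (1 ⊗ₜ v)) : F = G := by
  ext x
  have hε (v : V) : ε ⊗ₜ[k] v = ε • (1 : DualNumber k) ⊗ₜ[k] v := by
    rw [TensorProduct.smul_tmul', smul_eq_mul, mul_one]
  rw [← one_tmul_re_add_eps_tmul_im x, hε, map_add, map_add, map_smul, map_smul, h, h]

end Extended

/-- Every linear map `f` of vector spaces has a generalized inverse: a map `g` with `f g f = f`. -/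
lemma exists_generalizedInverse {k : Type*} [Field k] {V W : Type*}
    [AddCommGroup V] [Module k V] [AddCommGroup W] [Module k W] (f : V →ₗ[k] W) :
    ∃ g : W →ₗ[k] V, ∀ x, f (g (f x)) = f x := by
  obtain ⟨s, hs⟩ := f.rangeRestrict.exists_rightInverse_of_surjective f.range_rangeRestrict
  obtain ⟨g, hg⟩ := s.exists_extend
  refine ⟨g, fun x => ?_⟩
  have h₁ : g (f x) = s (f.rangeRestrict x) := LinearMap.congr_fun hg (f.rangeRestrict x)
  have h₂ := LinearMap.congr_fun hs (f.rangeRestrict x)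
  rw [h₁]
  exact congrArg Subtype.val h₂

end SHat

/-! ### The equivalence with the category of minimal complexes -/

namespace SHat

variable {k : Type u} [Field k]

lemma exists_toComplexMap {V W : SHat k} (φ : V.toComplex ⟶ W.toComplex) :
    ∃ f e, φ = toComplexMap f e := by
  choose f e h using fun i => exists_extHom (φ.f i)
  refine ⟨⟨f, fun i j hij => ?_⟩, e, ?_⟩
  · have := φ.comm i j
    rw [h i, h j, toComplex_d _ hij, toComplex_d _ hij] at this
    simpa using (extHom_injective
      ((extHom_comp _ _ _ _).symm.trans (this.trans (extHom_comp _ _ _ _)))).2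
  · ext i : 1
    exact h i

instance : (toK k).Full where
  map_surjective {V W} φ := by
    obtain ⟨φ, rfl⟩ := (HomotopyCategory.quotient _ _).map_surjective φ
    obtain ⟨f, e, rfl⟩ := exists_toComplexMap φ
    exact ⟨homMk f e, toK_map_homMk f e⟩

/-- A homotopy between morphisms of minimal complexes only contributes its component of
`ε`-degree `0`, multiplied by `ε`. -/
instance : (toK k).Faithful where
  map_injective {V W φ ψ} h := by
    obtain ⟨f, e, rfl⟩ := homMk_surj φ
    obtain ⟨f', e', rfl⟩ := homMk_surj ψ
    rw [toK_map_homMk, toK_map_homMk] at h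
    let H := HomotopyCategory.homotopyOfEq _ _ h
    choose a b hab using fun i j => exists_extHom (V := V.X i) (W := W.X j) (H.hom i j)
    have key : ∀ i, f.1 i = f'.1 i ∧ delta V W (fun p => a p.1.1 p.1.2) i + e' i = e i := by
      intro i
      have := H.comm i
      rw [dNext_eq _ (show (ComplexShape.up ℤ).Rel i (i + 1) from rfl),
        prevD_eq _ (show (ComplexShape.up ℤ).Rel (i - 1) i from sub_add_cancel i 1),
        toComplex_d V rfl, toComplex_d W (sub_add_cancel i 1)] at this
      erw [hab, hab, extHom_comp, extHom_comp, extHom_add, extHom_add] at this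
      obtain ⟨h₁, h₂⟩ := extHom_injective this
      refine ⟨by simpa using h₁, h₂.trans ?_ |>.symm⟩
      rw [delta_apply V W _ (sub_add_cancel i 1) rfl]
      simp only [LinearMap.comp_zero, LinearMap.zero_comp, add_zero, zero_add]
      abel
    rw [homMk_eq_iff]
    exact ⟨Subtype.ext (funext fun i => (key i).1), _,
      funext fun i => eq_sub_of_add_eq (key i).2⟩

lemma hom_linear_smul {M N : ModuleCat.{u} (DualNumber k)} (c : k) (F : M ⟶ N) :
    (c • F).hom = algebraMap k (DualNumber k) c • F.hom := rfl

lemma extHom_smul {V W : ModuleCat.{u} k} (c : k) (f e : V →ₗ[k] W) :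
    (extHom (c • f) (c • e)).hom = algebraMap k (DualNumber k) c • (extHom f e).hom := by
  refine LinearMap.ext fun x => ?_
  rw [LinearMap.smul_apply, algebraMap_smul]
  simp [extMap, smul_comm c, LinearMap.baseChange_smul]

instance : (toK k).Linear k where
  map_smul {V W} φ c := by
    obtain ⟨f, e, rfl⟩ := homMk_surj φ
    refine Eq.trans (congrArg (HomotopyCategory.quotient _ _).map ?_)
      ((HomotopyCategory.quotient _ _).map_smul c (toComplexMap f e))
    ext i : 1
    exact ModuleCat.hom_ext ((extHom_smul c _ _).trans (hom_linear_smul c _).symm)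

instance : (toK k).Additive where
  map_add {V W φ ψ} := by
    obtain ⟨f, e, rfl⟩ := homMk_surj φ
    obtain ⟨f', e', rfl⟩ := homMk_surj ψ
    refine Eq.trans (congrArg (HomotopyCategory.quotient _ _).map ?_)
      (HomotopyCategory.quotient _ _).map_add
    ext i : 1
    exact (extHom_add _ _ _ _).symm

/-- A minimal complex is isomorphic, as a complex, to the one attached to a sequence. -/
lemma exists_iso_toComplex (M : CochainComplex (ModuleCat.{u} (DualNumber k)) ℤ)
    (hfree : ∀ i, Module.Free (DualNumber k) (M.X i))
    (hd : ∀ i : ℤ, ∃ g : M.X i →ₗ[DualNumber k] M.X (i + 1),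
      M.d i (i + 1) = ModuleCat.ofHom ((DualNumber.eps : DualNumber k) • g)) :
    ∃ V : SHat k, Nonempty (V.toComplex ≅ M) := by
  choose X hX using fun i => exists_iso_extended (M.X i)
  let φ := fun i => (hX i).some
  choose g hg using hd
  choose a b hab using fun i => exists_extHom (V := X i) (W := X (i + 1))
    ((φ i).inv ≫ ModuleCat.ofHom (g i) ≫ (φ (i + 1)).hom)
  refine ⟨⟨X, fun i j h => h ▸ a i⟩, ⟨HomologicalComplex.Hom.isoOfComponents
    (fun i => (φ i).symm) ?_⟩⟩
  rintro i _ rfl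
  refine (Iso.eq_comp_inv (φ (i + 1))).2 ?_
  rw [toComplex_d _ rfl]
  refine Eq.trans ?_ (extHom_smul_eps _ (b i))
  rw [hg]
  have := congrArg ModuleCat.Hom.hom (hab i)
  refine ModuleCat.hom_ext ?_
  refine Eq.trans (LinearMap.ext fun x => ?_)
    (congrArg ((DualNumber.eps : DualNumber k) • ·) this)
  exact map_smul (φ (i + 1)).hom.hom _ _

instance : (toMinimal k).Full := inferInstanceAs ((minimal k).lift (toK k) minimal_toK).Full

instance : (toMinimal k).Faithful :=
  inferInstanceAs ((minimal k).lift (toK k) minimal_toK).Faithful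

instance : (toMinimal k).EssSurj where
  mem_essImage M := by
    obtain ⟨V, ⟨α⟩⟩ := exists_iso_toComplex _ M.property.1 M.property.2
    exact ⟨V, ⟨(minimal k).fullyFaithfulι.preimageIso
      ((HomotopyCategory.quotient _ _).mapIso α)⟩⟩

instance : (toMinimal k).IsEquivalence where

instance : (toMinimal k).Linear k where
  map_smul φ c := by
    exact (minimal k).ι.map_injective ((toK k).map_smul c φ)

instance : (toMinimal k).Additive where
  map_add {V W φ ψ} := by
    exact (minimal k).ι.map_injective (toK k).map_add

end SHat

/-! ### Minimal models of complexes of free modules -/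

/-- A complex of free modules over `k[ε]`, written as `k[ε] ⊗ V^i` with differential `d₀ + ε d`.
The conditions say that
`(d₀ + ε d)² = d₀² + ε (d₀ d + d d₀)` vanishes; there is none on `d²`. -/
structure FreeComplex (k : Type u) [Field k] extends SHat k where
  /-- the component of `ε`-degree `0` of the differential -/
  d₀ : ∀ i j : ℤ, i + 1 = j → (X i →ₗ[k] X j)
  d₀_d₀ : ∀ (i j l : ℤ) (hij : i + 1 = j) (hjl : j + 1 = l) (x : X i),
    d₀ j l hjl (d₀ i j hij x) = 0
  d_d₀ : ∀ (i j l : ℤ) (hij : i + 1 = j) (hjl : j + 1 = l) (x : X i),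
    d j l hjl (d₀ i j hij x) = - d₀ j l hjl (d i j hij x)

namespace FreeComplex

open SHat

variable {k : Type u} [Field k]

/-- The complex `k[ε] ⊗ V` with differential `d₀ + ε d`. -/
noncomputable def total (F : FreeComplex k) : CochainComplex (ModuleCat.{u} (DualNumber k)) ℤ where
  X i := ModuleCat.of (DualNumber k) (DualNumber k ⊗[k] F.X i)
  d i j := if h : i + 1 = j then extHom (F.d₀ i j h) (F.d i j h) else 0
  shape i j h := dif_neg h
  d_comp_d' i j l hij hjl := by
    rw [dif_pos (show i + 1 = j from hij), dif_pos (show j + 1 = l from hjl), extHom_comp,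
      ← extHom_zero]
    congr 1 <;> ext x
    · simp [F.d₀_d₀]
    · simp [F.d_d₀]

lemma total_d (F : FreeComplex k) {i j : ℤ} (h : i + 1 = j) :
    F.total.d i j = extHom (F.d₀ i j h) (F.d i j h) :=
  dif_pos h

/-- A complex of free `k[ε]`-modules is of the form `k[ε] ⊗ V` with differential `d₀ + ε d`. -/
lemma exists_iso_total (M : CochainComplex (ModuleCat.{u} (DualNumber k)) ℤ)
    (hfree : ∀ i, Module.Free (DualNumber k) (M.X i)) :
    ∃ F : FreeComplex k, Nonempty (F.total ≅ M) := by
  choose X hX using fun i => exists_iso_extended (M.X i)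
  let φ := fun i => (hX i).some
  choose a b hab using fun i j => exists_extHom (V := X i) (W := X j)
    ((φ i).inv ≫ M.d i j ≫ (φ j).hom)
  have hzero : ∀ i j l, extHom (a i j) (b i j) ≫ extHom (a j l) (b j l) = extHom 0 0 := by
    intro i j l
    rw [← hab, ← hab, extHom_zero]
    simp
  let F : FreeComplex k :=
    { X := X
      d := fun i j _ => b i j
      d₀ := fun i j _ => a i j
      d₀_d₀ := fun i j l _ _ x => by
        have := hzero i j l
        rw [extHom_comp] at this
        exact LinearMap.congr_fun (extHom_injective this).1 x
      d_d₀ := fun i j l _ _ x => by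
        have := hzero i j l
        rw [extHom_comp] at this
        exact eq_neg_of_add_eq_zero_right (LinearMap.congr_fun (extHom_injective this).2 x) }
  refine ⟨F, ⟨HomologicalComplex.Hom.isoOfComponents (fun i => (φ i).symm) ?_⟩⟩
  intro i j hij
  refine (Iso.eq_comp_inv (φ j)).2 ?_
  rw [total_d F hij]
  exact (Category.assoc _ _ _).trans (hab i j)

section Perturbation

variable (F : FreeComplex k)

/-- A splitting homotopy for the differential `d₀`: it exhibits the complex `(V, d₀)` as the direct
sum of a contractible complex and of a complex with zero differential. -/
structure Splitting where
  /-- the homotopy -/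
  h : ∀ i j : ℤ, j + 1 = i → (F.X i →ₗ[k] F.X j)
  d_h_d : ∀ (i j : ℤ) (hij : i + 1 = j) (x : F.X i),
    F.d₀ i j hij (h j i hij (F.d₀ i j hij x)) = F.d₀ i j hij x
  h_d_h : ∀ (i j : ℤ) (hij : i + 1 = j) (x : F.X j),
    h j i hij (F.d₀ i j hij (h j i hij x)) = h j i hij x
  h_h : ∀ (i j l : ℤ) (hij : i + 1 = j) (hjl : j + 1 = l) (x : F.X l),
    h j i hij (h l j hjl x) = 0

/-- For generalized inverses `g` of the maps `d₀`, the maps `g d₀ g (1 - g d₀)` form a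
splitting. -/
lemma nonempty_splitting : Nonempty F.Splitting := by
  choose g hg using fun i j hij => exists_generalizedInverse (F.d₀ i j hij)
  refine ⟨⟨fun i j hij => g j i hij ∘ₗ F.d₀ j i hij ∘ₗ g j i hij ∘ₗ
    (LinearMap.id - g i (i + 1) rfl ∘ₗ F.d₀ i (i + 1) rfl), ?_, ?_, ?_⟩⟩
  · intro i j hij x
    simp [hg, F.d₀_d₀]
  · intro i j hij x
    simp [hg, F.d₀_d₀]
  · rintro i j _ hij rfl x
    simp [hg]

namespace Splitting

variable {F} (S : F.Splitting)

/-- The projector `1 - d₀ h - h d₀`. -/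
def e (i : ℤ) : F.X i →ₗ[k] F.X i :=
  LinearMap.id - F.d₀ (i - 1) i (sub_add_cancel i 1) ∘ₗ S.h i (i - 1) (sub_add_cancel i 1) -
    S.h (i + 1) i rfl ∘ₗ F.d₀ i (i + 1) rfl

lemma e_apply {i j l : ℤ} (hij : i + 1 = j) (hjl : j + 1 = l) (x : F.X j) :
    S.e j x = x - F.d₀ i j hij (S.h j i hij x) - S.h l j hjl (F.d₀ j l hjl x) := by
  obtain rfl : i = j - 1 := by lia
  subst hjl
  rfl

lemma e_d₀ (i j : ℤ) (hij : i + 1 = j) (x : F.X i) : S.e j (F.d₀ i j hij x) = 0 := by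
  rw [S.e_apply hij rfl, S.d_h_d, F.d₀_d₀, map_zero, sub_self, sub_zero]

lemma d₀_e (i j : ℤ) (hij : i + 1 = j) (x : F.X i) : F.d₀ i j hij (S.e i x) = 0 := by
  rw [S.e_apply (sub_add_cancel i 1) hij, map_sub, map_sub, S.d_h_d, F.d₀_d₀, sub_zero, sub_self]

lemma e_h (i j : ℤ) (hij : j + 1 = i) (x : F.X i) : S.e j (S.h i j hij x) = 0 := by
  rw [S.e_apply (sub_add_cancel j 1) hij, S.h_h, S.h_d_h, map_zero, sub_zero, sub_self]

lemma h_e (i j : ℤ) (hij : j + 1 = i) (x : F.X i) : S.h i j hij (S.e i x) = 0 := by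
  rw [S.e_apply hij rfl, map_sub, map_sub, S.h_h, S.h_d_h, sub_zero, sub_self]

lemma e_e (i : ℤ) (x : F.X i) : S.e i (S.e i x) = S.e i x := by
  rw [S.e_apply (x := S.e i x) (sub_add_cancel i 1) rfl, S.h_e, S.d₀_e, map_zero, map_zero,
    sub_zero, sub_zero]

/-- The inclusion of the image of the projector. -/
def incl (i : ℤ) : LinearMap.range (S.e i) →ₗ[k] F.X i := (LinearMap.range (S.e i)).subtype

/-- The projection onto the image of the projector. -/
def proj (i : ℤ) : F.X i →ₗ[k] LinearMap.range (S.e i) := (S.e i).rangeRestrict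

lemma incl_proj (i : ℤ) (x : F.X i) : S.incl i (S.proj i x) = S.e i x := rfl

lemma proj_eq_zero {i : ℤ} {x : F.X i} (h : S.e i x = 0) : S.proj i x = 0 := Subtype.ext h

lemma e_incl (i : ℤ) (y : LinearMap.range (S.e i)) : S.e i (S.incl i y) = S.incl i y := by
  obtain ⟨_, x, rfl⟩ := y
  exact S.e_e i x

lemma proj_incl (i : ℤ) (y : LinearMap.range (S.e i)) : S.proj i (S.incl i y) = y :=
  Subtype.ext (S.e_incl i y)

lemma d₀_incl (i j : ℤ) (hij : i + 1 = j) (y : LinearMap.range (S.e i)) :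
    F.d₀ i j hij (S.incl i y) = 0 := by
  rw [← S.e_incl, S.d₀_e]

lemma h_incl (i j : ℤ) (hij : j + 1 = i) (y : LinearMap.range (S.e i)) :
    S.h i j hij (S.incl i y) = 0 := by
  rw [← S.e_incl, S.h_e]

lemma proj_d₀ (i j : ℤ) (hij : i + 1 = j) (x : F.X i) : S.proj j (F.d₀ i j hij x) = 0 :=
  S.proj_eq_zero (S.e_d₀ i j hij x)

lemma proj_h (i j : ℤ) (hij : j + 1 = i) (x : F.X i) : S.proj j (S.h i j hij x) = 0 :=
  S.proj_eq_zero (S.e_h i j hij x)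

/-- The minimal model: the image of the projector, with the maps induced by `d`. As `F.d` commutes
with `d₀` up to sign, this is the sequence of the cohomology spaces of `d₀`. -/
def model : SHat k where
  X i := ModuleCat.of k (LinearMap.range (S.e i))
  d i j hij := S.proj j ∘ₗ F.d i j hij ∘ₗ S.incl i

/-- The composition `h d`. -/
def hd (i : ℤ) : F.X i →ₗ[k] F.X i := S.h (i + 1) i rfl ∘ₗ F.d i (i + 1) rfl

lemma hd_apply {i j : ℤ} (hij : i + 1 = j) (x : F.X i) :
    S.hd i x = S.h j i hij (F.d i j hij x) := by
  subst hij; rfl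

/-- The composition `d h`. -/
def dh (i : ℤ) : F.X i →ₗ[k] F.X i :=
  F.d (i - 1) i (sub_add_cancel i 1) ∘ₗ S.h i (i - 1) (sub_add_cancel i 1)

lemma dh_apply {i j : ℤ} (hij : j + 1 = i) (x : F.X i) :
    S.dh i x = F.d j i hij (S.h i j hij x) := by
  obtain rfl : j = i - 1 := by lia
  rfl

/-- The perturbed inclusion `ι - ε h d ι` of the minimal model. -/
noncomputable def inclTotal : S.model.toComplex ⟶ F.total where
  f i := extHom (V := S.model.X i) (S.incl i) (-(S.hd i ∘ₗ S.incl i))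
  comm' := by
    rintro i j hij
    have hij' : i + 1 = j := hij
    rw [total_d F hij', toComplex_d _ hij']
    refine (extHom_comp _ _ _ _).trans (Eq.trans ?_ (extHom_comp _ _ _ _).symm)
    congr 1 <;> refine LinearMap.ext fun (y : LinearMap.range (S.e i)) => ?_
    · exact (S.d₀_incl i j hij' y).trans (map_zero (S.incl j)).symm
    · have h₁ := S.e_apply hij' rfl (F.d i j hij' (S.incl i y))
      have h₂ := F.d_d₀ i j _ hij' rfl (S.incl i y)
      rw [S.d₀_incl, map_zero, zero_eq_neg] at h₂
      rw [h₂, map_zero, sub_zero] at h₁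
      change F.d₀ i j hij' (-S.hd i (S.incl i y)) + F.d i j hij' (S.incl i y) =
        S.incl j (S.proj j (F.d i j hij' (S.incl i y))) + -(S.hd j (S.incl j 0))
      rw [S.incl_proj, h₁, S.hd_apply hij', map_neg, map_zero, map_zero]
      abel

/-- The perturbed projection `π - ε π d h` onto the minimal model. -/
noncomputable def projTotal : F.total ⟶ S.model.toComplex where
  f i := extHom (W := S.model.X i) (S.proj i) (-(S.proj i ∘ₗ S.dh i))
  comm' := by
    rintro i j hij
    have hij' : i + 1 = j := hij
    rw [total_d F hij', toComplex_d _ hij']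
    refine (extHom_comp _ _ _ _).trans (Eq.trans ?_ (extHom_comp _ _ _ _).symm)
    congr 1 <;> refine LinearMap.ext fun x => ?_
    · exact (S.proj_d₀ i j hij' x).symm
    · have h₁ := S.e_apply (sub_add_cancel i 1) hij' x
      have h₂ := F.d_d₀ _ i j (sub_add_cancel i 1) hij' (S.h i (i - 1) (sub_add_cancel i 1) x)
      change 0 + S.proj j (F.d i j hij' (S.incl i (S.proj i x))) =
        S.proj j (F.d i j hij' x) + -S.proj j (S.dh j (F.d₀ i j hij' x))
      rw [S.incl_proj, h₁, S.dh_apply hij', map_sub, map_sub, map_sub, map_sub, h₂, map_neg,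
        S.proj_d₀]
      abel

lemma inclTotal_projTotal : S.inclTotal ≫ S.projTotal = 𝟙 _ := by
  ext i : 1
  refine (extHom_comp _ _ _ _).trans (Eq.trans ?_ (extHom_id _))
  congr 1 <;> refine LinearMap.ext fun (y : LinearMap.range (S.e i)) => ?_
  · exact S.proj_incl i y
  · change S.proj i (-S.hd i (S.incl i y)) + -S.proj i (S.dh i (S.incl i y)) = 0
    rw [S.hd_apply rfl, S.dh_apply (sub_add_cancel i 1), S.h_incl, map_neg, S.proj_h]
    simp

/-- The components `h - ε h d h` of the perturbed homotopy. -/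
noncomputable def homTotal (i j : ℤ) : F.total.X i ⟶ F.total.X j :=
  if hij : j + 1 = i then extHom (S.h i j hij) (-(S.hd j ∘ₗ S.h i j hij)) else 0

lemma homTotal_eq {i j : ℤ} (hij : j + 1 = i) :
    S.homTotal i j = extHom (S.h i j hij) (-(S.hd j ∘ₗ S.h i j hij)) :=
  dif_pos hij

/-- The perturbed homotopy `h - ε h d h`. -/
noncomputable def homotopyTotal : Homotopy (𝟙 F.total) (S.projTotal ≫ S.inclTotal) where
  hom := S.homTotal
  zero i j hij := dif_neg hij
  comm i := by
    rw [dNext_eq _ (show (ComplexShape.up ℤ).Rel i (i + 1) from rfl),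
      prevD_eq _ (show (ComplexShape.up ℤ).Rel (i - 1) i from sub_add_cancel i 1),
      total_d F rfl, total_d F (sub_add_cancel i 1), S.homTotal_eq rfl,
      S.homTotal_eq (sub_add_cancel i 1)]
    refine Eq.trans (extHom_id _).symm (Eq.symm ?_)
    let add (a b : F.total.X i ⟶ F.total.X i) := a + b
    refine (congrArg₂ add (congrArg₂ add (extHom_comp _ _ _ _) (extHom_comp _ _ _ _))
      (extHom_comp _ _ _ _)).trans ?_
    refine (congrArg (add · _) (extHom_add _ _ _ _)).trans ((extHom_add _ _ _ _).trans ?_)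
    have hi := sub_add_cancel i 1
    congr 1 <;> refine LinearMap.ext fun x => ?_
    · change S.h (i + 1) i rfl (F.d₀ i (i + 1) rfl x) + F.d₀ (i - 1) i hi (S.h i (i - 1) hi x) +
        S.e i x = x
      rw [S.e_apply hi rfl]
      abel
    · change S.h (i + 1) i rfl (F.d i (i + 1) rfl x) +
          -(S.hd i (S.h (i + 1) i rfl (F.d₀ i (i + 1) rfl x))) +
        (F.d₀ (i - 1) i hi (-(S.hd (i - 1) (S.h i (i - 1) hi x))) +
          F.d (i - 1) i hi (S.h i (i - 1) hi x)) +
        (S.incl i (-(S.proj i (S.dh i x))) + -(S.hd i (S.incl i (S.proj i x)))) = 0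
      rw [map_neg (S.incl i), S.incl_proj, S.incl_proj, S.e_apply hi rfl, S.e_apply hi rfl,
        S.dh_apply hi]
      simp only [S.hd_apply (i := i) rfl, S.hd_apply hi, map_sub, map_neg, F.d_d₀]
      abel

/-- The perturbation lemma: the complex `k[ε] ⊗ V` is homotopy equivalent to the complex of its
minimal model. All correction terms are linear in `ε`, as `ε² = 0`. -/
noncomputable def homotopyEquiv : HomotopyEquiv F.total S.model.toComplex where
  hom := S.projTotal
  inv := S.inclTotal
  homotopyHomInvId := S.homotopyTotal.symm
  homotopyInvHomId := Homotopy.ofEq S.inclTotal_projTotal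

end Splitting

end Perturbation

end FreeComplex

/-! ### The triangulated structure -/

namespace SHat

variable {k : Type u} [Field k]

/-- A complex of free modules is homotopy equivalent to the complex of a sequence. -/
lemma exists_homotopyEquiv_toComplex (M : CochainComplex (ModuleCat.{u} (DualNumber k)) ℤ)
    (hfree : ∀ i, Module.Free (DualNumber k) (M.X i)) :
    ∃ V : SHat k, Nonempty (HomotopyEquiv V.toComplex M) := by
  obtain ⟨F, ⟨α⟩⟩ := FreeComplex.exists_iso_total M hfree
  obtain ⟨S⟩ := F.nonempty_splitting
  exact ⟨S.model, ⟨S.homotopyEquiv.symm.trans (HomotopyEquiv.ofIso α)⟩⟩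

lemma minimal_isoClosure_of_free (M : CochainComplex (ModuleCat.{u} (DualNumber k)) ℤ)
    (hfree : ∀ i, Module.Free (DualNumber k) (M.X i)) :
    (minimal k).isoClosure ((HomotopyCategory.quotient _ _).obj M) := by
  obtain ⟨V, ⟨α⟩⟩ := exists_homotopyEquiv_toComplex M hfree
  exact ⟨_, minimal_toK V, ⟨(HomotopyCategory.isoOfHomotopyEquiv α).symm⟩⟩

lemma free_mappingCone {M N : CochainComplex (ModuleCat.{u} (DualNumber k)) ℤ} (φ : M ⟶ N)
    (hM : ∀ i, Module.Free (DualNumber k) (M.X i))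
    (hN : ∀ i, Module.Free (DualNumber k) (N.X i)) (i : ℤ) :
    Module.Free (DualNumber k) ((CochainComplex.mappingCone φ).X i) := by
  have α := HomologicalComplex.homotopyCofiber.XIsoBiprod φ i (i + 1) rfl ≪≫
    ModuleCat.biprodIsoProd _ _
  have := hM (i + 1)
  have := hN i
  exact Module.Free.of_equiv (M := (M.X (i + 1) × N.X i)) α.symm.toLinearEquiv

lemma shift_obj_eq (M : CochainComplex (ModuleCat.{u} (DualNumber k)) ℤ) (n : ℤ) :
    ((HomotopyCategory.quotient _ _).obj M : K k)⟦n⟧ =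
      (HomotopyCategory.quotient _ _).obj (M⟦n⟧) :=
  Quotient.functor_obj_shift _ _ M n

scoped instance : (minimal k).IsStableUnderShift ℤ where
  isStableUnderShiftBy n :=
    { le_shift := by
        intro M hM
        obtain ⟨M, rfl⟩ := HomotopyCategory.quotient_obj_surjective M
        obtain ⟨hfree, hd⟩ := hM
        change minimal k (((HomotopyCategory.quotient _ _).obj M : K k)⟦n⟧)
        rw [shift_obj_eq]
        refine ⟨fun i => hfree (i + n), fun i => ?_⟩
        obtain ⟨g, hg⟩ : ∃ g : M.X (i + n) →ₗ[DualNumber k] M.X (i + n + 1),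
            M.d (i + n) (i + n + 1) = ModuleCat.ofHom ((DualNumber.eps : DualNumber k) • g) :=
          hd (i + n)
        have key : ∀ j : ℤ, j = i + n + 1 → ∃ g' : M.X (i + n) →ₗ[DualNumber k] M.X j,
            n.negOnePow • M.d (i + n) j =
              ModuleCat.ofHom ((DualNumber.eps : DualNumber k) • g') := by
          rintro _ rfl
          rw [hg]
          rcases Int.units_eq_one_or n.negOnePow with h | h <;> rw [h]
          · exact ⟨g, one_smul _ _⟩
          · refine ⟨-g, ?_⟩
            rw [Units.neg_smul, one_smul]
            ext x
            simp
        exact key (i + 1 + n) (by lia) }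

scoped instance : (minimal k).ContainsZero where
  exists_zero := by
    obtain ⟨V, hV⟩ := (inferInstance : HasZeroObject (SHat k)).zero
    exact ⟨_, (toK k).map_isZero hV, minimal_toK V⟩

open Pretriangulated

scoped instance : (minimal k).IsTriangulatedClosed₃ where
  ext₃' := by
    rintro ⟨X, Y, Z, f, g, h⟩ hT h₁ h₂
    obtain ⟨X, rfl⟩ := HomotopyCategory.quotient_obj_surjective X
    obtain ⟨Y, rfl⟩ := HomotopyCategory.quotient_obj_surjective Y
    obtain ⟨φ, rfl⟩ := (HomotopyCategory.quotient _ _).map_surjective f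
    have α := isoTriangleOfIso₁₂ _ _
      (HomotopyCategory.mappingCone_triangleh_distinguished φ) hT (Iso.refl _) (Iso.refl _)
      ((Category.comp_id _).trans (Category.id_comp _).symm)
    exact (minimal k).isoClosure.prop_of_iso (Triangle.π₃.mapIso α)
      (minimal_isoClosure_of_free _ (free_mappingCone φ h₁.1 h₂.1))

scoped instance : (minimal k).IsTriangulatedClosed₂ :=
  ObjectProperty.IsTriangulatedClosed₂.of_isTriangulatedClosed₃

scoped instance : (minimal k).IsTriangulated where

end SHat

section InducedPretriangulated

open Pretriangulated

variable {C D : Type*} [Category C] [Category D] [HasZeroObject C] [HasZeroObject D]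
  [Preadditive C] [Preadditive D] [HasShift C ℤ] [HasShift D ℤ]
  [∀ n : ℤ, (shiftFunctor C n).Additive] [∀ n : ℤ, (shiftFunctor D n).Additive]
  [Pretriangulated D] (G : C ⥤ D) [G.CommShift ℤ] [G.Additive]

/-- The pretriangulated structure transported along an equivalence commuting with the shifts: the
distinguished triangles are those with a distinguished image. -/
noncomputable abbrev inducedPretriangulated [G.IsEquivalence] : Pretriangulated C where
  distinguishedTriangles := {T | G.mapTriangle.obj T ∈ distTriang D}
  isomorphic_distinguished T₁ hT₁ T₂ e :=
    isomorphic_distinguished _ hT₁ _ (G.mapTriangle.mapIso e)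
  contractible_distinguished X := by
    refine isomorphic_distinguished _ (contractible_distinguished (G.obj X)) _
      (Triangle.isoMk _ _ (Iso.refl _) (Iso.refl _) G.mapZeroObject ?_ ?_ ?_)
    · change G.map (𝟙 X) ≫ 𝟙 _ = 𝟙 _ ≫ 𝟙 (G.obj X)
      rw [G.map_id]
    · exact (isZero_zero D).eq_of_tgt _ _
    · exact (G.map_isZero (isZero_zero C)).eq_of_src _ _
  distinguished_cocone_triangle {X Y} f := by
    obtain ⟨Z', g', h', mem⟩ := distinguished_cocone_triangle (G.map f)
    let e : G.obj (G.objPreimage Z') ≅ Z' := G.objObjPreimageIso Z'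
    refine ⟨G.objPreimage Z', G.preimage (g' ≫ e.inv),
      G.preimage (e.hom ≫ h' ≫ (G.commShiftIso (1 : ℤ)).inv.app X),
      isomorphic_distinguished _ mem _
        (Triangle.isoMk _ _ (Iso.refl _) (Iso.refl _) e ?_ ?_ ?_)⟩
    · exact (Category.comp_id _).trans (Category.id_comp _).symm
    · change G.map (G.preimage (g' ≫ e.inv)) ≫ e.hom = 𝟙 _ ≫ g'
      rw [G.map_preimage, Category.assoc, e.inv_hom_id, Category.comp_id, Category.id_comp]
    · change (G.map (G.preimage (e.hom ≫ h' ≫ (G.commShiftIso (1 : ℤ)).inv.app X)) ≫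
        (G.commShiftIso (1 : ℤ)).hom.app X) ≫ (𝟙 (G.obj X))⟦(1 : ℤ)⟧' = e.hom ≫ h'
      rw [G.map_preimage, CategoryTheory.Functor.map_id]
      refine (Category.comp_id _).trans ?_
      rw [Category.assoc, Category.assoc, Iso.inv_hom_id_app]
      exact congrArg (e.hom ≫ ·) (Category.comp_id _)
  rotate_distinguished_triangle T :=
    (rotate_distinguished_triangle (G.mapTriangle.obj T)).trans
      (distinguished_iff_of_iso (G.mapTriangleRotateIso.app T))
  complete_distinguished_triangle_morphism T₁ T₂ hT₁ hT₂ a b comm := by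
    obtain ⟨c, ⟨hc₁, hc₂⟩⟩ := complete_distinguished_triangle_morphism (G.mapTriangle.obj T₁)
      (G.mapTriangle.obj T₂) hT₁ hT₂ (G.map a) (G.map b)
      ((G.map_comp _ _).symm.trans ((G.congr_map comm).trans (G.map_comp _ _)))
    change G.obj T₁.obj₃ ⟶ G.obj T₂.obj₃ at c
    change G.map T₁.mor₂ ≫ c = G.map b ≫ G.map T₂.mor₂ at hc₁
    change (G.map T₁.mor₃ ≫ (G.commShiftIso (1 : ℤ)).hom.app T₁.obj₁) ≫ (G.map a)⟦(1 : ℤ)⟧' =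
      c ≫ G.map T₂.mor₃ ≫ (G.commShiftIso (1 : ℤ)).hom.app T₂.obj₁ at hc₂
    refine ⟨G.preimage c, ⟨G.map_injective ?_, G.map_injective ?_⟩⟩
    · rw [G.map_comp, G.map_preimage, hc₁, G.map_comp]
    · rw [← cancel_mono ((G.commShiftIso (1 : ℤ)).hom.app T₂.obj₁), G.map_comp, Category.assoc,
        G.commShiftIso_hom_naturality a (1 : ℤ), G.map_comp, G.map_preimage, Category.assoc,
        ← hc₂, Category.assoc]

end InducedPretriangulated

namespace SHat

open Pretriangulated

variable {k : Type u} [Field k]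

noncomputable scoped instance : Pretriangulated (SHat k) := inducedPretriangulated (toMinimal k)

instance : (toMinimal k).IsTriangulated where
  map_distinguished _ hT := hT

instance : (toK k).IsTriangulated := by
  have : (toMinimal k ⋙ (minimal k).ι).IsTriangulated := inferInstance
  exact (Functor.isTriangulated_iff_of_iso ((minimal k).liftCompιIso (toK k) minimal_toK)).1 this

scoped instance : IsTriangulated (SHat k) :=
  IsTriangulated.of_fully_faithful_triangulated_functor (toMinimal k)

end SHat

/-! ### Locally nilpotent sequences -/

namespace SHat

variable {k : Type u} [Field k]

/-- The elements killed by the composition of `n` consecutive maps of the sequence. -/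
def kerPow (V : SHat k) : ℕ → ∀ i : ℤ, Submodule k (V.X i)
  | 0, _ => ⊥
  | n + 1, i => (V.kerPow n (i + 1)).comap (V.d i (i + 1) rfl)

lemma mem_kerPow_zero {V : SHat k} {i : ℤ} {v : V.X i} : v ∈ V.kerPow 0 i ↔ v = 0 := Iff.rfl

lemma mem_kerPow_succ {V : SHat k} {n : ℕ} {i j : ℤ} (hij : i + 1 = j) {v : V.X i} :
    v ∈ V.kerPow (n + 1) i ↔ V.d i j hij v ∈ V.kerPow n j := by
  subst hij; rfl

lemma kerPow_mono_succ (V : SHat k) (n : ℕ) (i : ℤ) : V.kerPow n i ≤ V.kerPow (n + 1) i := by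
  induction n generalizing i with
  | zero => exact bot_le
  | succ n ih => exact Submodule.comap_mono (ih (i + 1))

lemma kerPow_mono (V : SHat k) (i : ℤ) : Monotone fun n => V.kerPow n i :=
  monotone_nat_of_le_succ fun n => V.kerPow_mono_succ n i

/-- A sequence is locally nilpotent if each element is killed by a composition of consecutive
maps. -/
def LocallyNilpotent (V : SHat k) : Prop := ∀ (i : ℤ) (v : V.X i), ∃ n, v ∈ V.kerPow n i

namespace LocallyNilpotent

variable {V : SHat k}

section Recursion

variable {N : ℤ → Type*} [∀ i, AddCommGroup (N i)] [∀ i, Module k (N i)]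
  (a : ∀ i j : ℤ, j + 1 = i → (V.X i →ₗ[k] N j)) (b : ∀ i j : ℤ, j + 1 = i → (N i →ₗ[k] N j))

/-- The successive approximations of the solution of `s = a + b s d`. -/
def approx : ℕ → ∀ i j : ℤ, j + 1 = i → (V.X i →ₗ[k] N j)
  | 0, _, _, _ => 0
  | n + 1, i, j, h => a i j h + b i j h ∘ₗ approx n (i + 1) i rfl ∘ₗ V.d i (i + 1) rfl

lemma approx_succ_eq (n : ℕ) {i j : ℤ} (h : j + 1 = i) {v : V.X i} (hv : v ∈ V.kerPow n i) :
    approx a b (n + 1) i j h v = approx a b n i j h v := by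
  induction n generalizing i j with
  | zero => rw [mem_kerPow_zero.1 hv, map_zero, map_zero]
  | succ n ih =>
    change a i j h v + b i j h (approx a b (n + 1) _ _ _ (V.d i (i + 1) rfl v)) =
      a i j h v + b i j h (approx a b n _ _ _ (V.d i (i + 1) rfl v))
    rw [ih rfl ((mem_kerPow_succ rfl).1 hv)]

lemma approx_eq_of_le {n m : ℕ} (hnm : n ≤ m) {i j : ℤ} (h : j + 1 = i) {v : V.X i}
    (hv : v ∈ V.kerPow n i) : approx a b m i j h v = approx a b n i j h v := by
  induction m, hnm using Nat.le_induction with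
  | base => rfl
  | succ m hm ih => rw [approx_succ_eq a b m h (V.kerPow_mono i hm hv), ih]

/-- On a locally nilpotent sequence, equations of the form `s = a + b s d` can be solved: the series
`a + b a d + b b a d d + ⋯` is locally finite. -/
lemma exists_solution (hV : V.LocallyNilpotent) :
    ∃ s : ∀ i j : ℤ, j + 1 = i → (V.X i →ₗ[k] N j),
    ∀ (i j l : ℤ) (h : j + 1 = i) (h' : i + 1 = l) (v : V.X i),
      s i j h v = a i j h v + b i j h (s l i h' (V.d i l h' v)) := by
  choose n hn using hV
  have key : ∀ (m : ℕ) {i j : ℤ} (h : j + 1 = i) {v : V.X i}, v ∈ V.kerPow m i →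
      approx a b (n i v) i j h v = approx a b m i j h v := fun m i j h v hv => by
    rw [← approx_eq_of_le a b (le_max_left (n i v) m) h (hn i v),
      approx_eq_of_le a b (le_max_right (n i v) m) h hv]
  refine ⟨fun i j h =>
    { toFun := fun v => approx a b (n i v) i j h v
      map_add' := fun v w => ?_
      map_smul' := fun c v => ?_ }, ?_⟩
  · have hv := V.kerPow_mono i (le_max_left (n i v) (n i w)) (hn i v)
    have hw := V.kerPow_mono i (le_max_right (n i v) (n i w)) (hn i w)
    rw [key _ h hv, key _ h hw, key _ h (Submodule.add_mem _ hv hw), map_add]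
  · rw [key _ h (Submodule.smul_mem _ c (hn i v)), map_smul]
    rfl
  · rintro i j _ h rfl v
    have hv : V.d i (i + 1) rfl v ∈ V.kerPow (n i v) (i + 1) :=
      (mem_kerPow_succ rfl).1 (V.kerPow_mono_succ _ _ (hn i v))
    change approx a b (n i v) i j h v =
      a i j h v + b i j h (approx a b (n (i + 1) _) (i + 1) i rfl (V.d i (i + 1) rfl v))
    rw [key _ rfl hv, ← approx_succ_eq a b _ h (hn i v)]
    rfl

end Recursion

section Contraction

variable {N : ℤ → Type u} [∀ i, AddCommGroup (N i)] [∀ i, Module k (N i)]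
  [∀ i, Module (DualNumber k) (N i)] [∀ i, IsScalarTower k (DualNumber k) (N i)]

/-- A morphism from the complex of a locally nilpotent sequence to an exact complex `N` is
null-homotopic, in terms of linear maps from `V`: a linear section `σ` of the differential of `N`
on the cocycles reduces the condition on the homotopy to `s = σ (φ - ε s d)`. -/
lemma exists_contraction (hV : V.LocallyNilpotent) (dN : ∀ i j : ℤ, N i →ₗ[DualNumber k] N j)
    (hexact : ∀ i j l : ℤ, i + 1 = j → j + 1 = l → ∀ x : N j, dN j l x = 0 → ∃ y, dN i j y = x)
    (φ : ∀ i, V.X i →ₗ[k] N i)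
    (hφ : ∀ (i j : ℤ) (h : i + 1 = j) (v : V.X i),
      dN i j (φ i v) = (DualNumber.eps : DualNumber k) • φ j (V.d i j h v)) :
    ∃ s : ∀ i j : ℤ, j + 1 = i → (V.X i →ₗ[k] N j),
      ∀ (i j l : ℤ) (h : j + 1 = i) (h' : i + 1 = l) (v : V.X i),
        dN j i (s i j h v) + (DualNumber.eps : DualNumber k) • s l i h' (V.d i l h' v) = φ i v := by
  choose σ hσ using fun i j => exists_generalizedInverse ((dN i j).restrictScalars k)
  let ε (i : ℤ) : N i →ₗ[k] N i :=
    ((DualNumber.eps : DualNumber k) • (LinearMap.id : N i →ₗ[DualNumber k] N i)).restrictScalars k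
  obtain ⟨s, hs⟩ := hV.exists_solution (N := N) (fun i j _ => σ j i ∘ₗ φ i)
    (fun i j _ => -(σ j i ∘ₗ ε i))
  refine ⟨s, fun i j l h h' v => ?_⟩
  obtain ⟨n, hn⟩ := hV i v
  induction n generalizing i j l with
  | zero => rw [mem_kerPow_zero.1 hn]; simp
  | succ n ih =>
    have hs' : s i j h v = σ j i (φ i v - (DualNumber.eps : DualNumber k) •
        s l i h' (V.d i l h' v)) := by
      rw [hs i j l h h' v, map_sub, sub_eq_add_neg]
      rfl
    have hcocycle : dN i l (φ i v - (DualNumber.eps : DualNumber k) •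
        s l i h' (V.d i l h' v)) = 0 := by
      rw [map_sub, map_smul, hφ i l h' v, ← smul_sub,
        ← ih l i (l + 1) h' rfl (V.d i l h' v) ((mem_kerPow_succ h').1 hn), add_sub_cancel_left,
        smul_smul, DualNumber.eps_mul_eps, zero_smul]
    obtain ⟨y, hy⟩ := hexact j i l h h' _ hcocycle
    have := hσ j i y
    simp only [LinearMap.restrictScalars_apply] at this
    rw [hs', ← hy, this, hy, sub_add_cancel]

end Contraction

/-- The complex of a locally nilpotent sequence is h-projective. -/
lemma isKProjective (hV : V.LocallyNilpotent) : V.toComplex.IsKProjective where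
  nonempty_homotopy_zero {N} f hN := by
    let (i : ℤ) : Module k (N.X i) := Module.compHom _ (algebraMap k (DualNumber k))
    have (i : ℤ) : IsScalarTower k (DualNumber k) (N.X i) :=
      .of_algebraMap_smul fun _ _ => rfl
    let φ (i : ℤ) : DualNumber k ⊗[k] V.X i →ₗ[DualNumber k] N.X i := (f.f i).hom
    obtain ⟨s, hs⟩ := hV.exists_contraction (N := fun i => N.X i) (fun i j => (N.d i j).hom)
      (fun i j l hij hjl x hx => by
        have := (N.exactAt_iff' i j l (by simp [← hij]) (by simp [hjl])).1 (hN j)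
        exact (ShortComplex.moduleCat_exact_iff _).1 this x hx)
      (fun i => (φ i).restrictScalars k ∘ₗ TensorProduct.mk k (DualNumber k) (V.X i) 1)
      (fun i j h v => by
        have := f.comm i j
        rw [toComplex_d V h] at this
        refine (LinearMap.congr_fun (congrArg ModuleCat.Hom.hom this) (1 ⊗ₜ v)).trans ?_
        refine (congrArg (φ j) (extMap_zero_one_tmul _ _)).trans (map_smul (φ j) _ _))
    let S (i j : ℤ) : V.toComplex.X i ⟶ N.X j :=
      if h : j + 1 = i then ModuleCat.ofHom ((s i j h).liftBaseChange (DualNumber k)) else 0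
    have hS {i j : ℤ} (h : j + 1 = i) :
        S i j = ModuleCat.ofHom ((s i j h).liftBaseChange (DualNumber k)) := dif_pos h
    refine ⟨{ hom := S, zero := fun i j h => dif_neg h, comm := fun i => ?_ }⟩
    have hi := sub_add_cancel i 1
    rw [dNext_eq _ (show (ComplexShape.up ℤ).Rel i (i + 1) from rfl),
      prevD_eq _ (show (ComplexShape.up ℤ).Rel (i - 1) i from hi), toComplex_d V rfl,
      hS rfl, hS hi, HomologicalComplex.zero_f, add_zero]
    refine ModuleCat.hom_ext
      (ext_one_tmul fun v => Eq.trans (hs i (i - 1) (i + 1) hi rfl v).symm ?_)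
    change _ = (s (i + 1) i rfl).liftBaseChange (DualNumber k)
        (extMap (DualNumber.eps : DualNumber k) 0 (V.d i (i + 1) rfl) (1 ⊗ₜ v)) +
      (N.d (i - 1) i).hom ((s i (i - 1) hi).liftBaseChange (DualNumber k) (1 ⊗ₜ v))
    rw [extMap_zero_one_tmul, map_smul, LinearMap.liftBaseChange_one_tmul,
      LinearMap.liftBaseChange_one_tmul, add_comm]

end LocallyNilpotent

end SHat

/-! ### Resolutions by locally nilpotent sequences -/

namespace FreeComplex.Splitting

open SHat

variable {k : Type u} [Field k] {F : FreeComplex k} (S : F.Splitting)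

/-- The projection to the minimal model intertwines `d` with the maps of the model on the cocycles
for `d₀`. -/
lemma proj_mem_kerPow {n : ℕ} {i : ℤ} {z : F.X i} (hz : F.d₀ i (i + 1) rfl z = 0)
    (hn : z ∈ F.toSHat.kerPow n i) : S.proj i z ∈ S.model.kerPow n i := by
  induction n generalizing i with
  | zero => rw [mem_kerPow_zero.1 hn, map_zero]; exact Submodule.zero_mem _
  | succ n ih =>
    rw [mem_kerPow_succ rfl] at hn
    refine (mem_kerPow_succ rfl).2 ?_
    have h : S.proj (i + 1) (F.d i (i + 1) rfl (S.incl i (S.proj i z))) =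
        S.proj (i + 1) (F.d i (i + 1) rfl z) := by
      rw [S.incl_proj, S.e_apply (sub_add_cancel i 1) rfl, hz, map_zero, sub_zero, map_sub,
        F.d_d₀, map_sub, map_neg, S.proj_d₀, neg_zero, sub_zero]
    change S.proj (i + 1) (F.d i (i + 1) rfl (S.incl i (S.proj i z))) ∈ _
    rw [h]
    refine ih ?_ hn
    rw [← neg_eq_zero, ← F.d_d₀ i (i + 1) _ rfl rfl, hz, map_zero]

lemma locallyNilpotent_model (hF : F.toSHat.LocallyNilpotent) :
    S.model.LocallyNilpotent := fun i y => by
  obtain ⟨n, hn⟩ := hF i (S.incl i y)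
  exact ⟨n, S.proj_incl i y ▸ S.proj_mem_kerPow (S.d₀_incl i _ rfl y) hn⟩

end FreeComplex.Splitting

/-- A criterion, in terms of elements, for the mapping cone to be acyclic. -/
lemma CochainComplex.mappingCone_acyclic_of_forall_exists {R : Type*} [Ring R]
    {F G : CochainComplex (ModuleCat.{u} R) ℤ} (φ : F ⟶ G)
    (h : ∀ (i j l : ℤ) (_ : i + 1 = j) (_ : j + 1 = l) (a : F.X j) (b : G.X i),
      F.d j l a = 0 → φ.f j a + G.d i j b = 0 → ∃ c : F.X i, F.d i j c = -a ∧ φ.f i c = b) :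
    (mappingCone φ).Acyclic := fun i => by
  rw [HomologicalComplex.exactAt_iff' _ (i - 1) i (i + 1) (by simp) (by simp),
    ShortComplex.moduleCat_exact_iff]
  intro x (hx : ((mappingCone φ).d i (i + 1)).hom x = 0)
  let a : F.X (i + 1) := ((mappingCone.fst φ).1.v i (i + 1) rfl).hom x
  let b : G.X i := ((mappingCone.snd φ).v i i (add_zero i)).hom x
  have h₁ : ((mappingCone.fst φ).1.v (i + 1) (i + 1 + 1) rfl).hom
      (((mappingCone φ).d i (i + 1)).hom x) = -(F.d (i + 1) (i + 1 + 1)).hom a :=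
    LinearMap.congr_fun (congrArg ModuleCat.Hom.hom
      (mappingCone.d_fst_v φ i (i + 1) (i + 1 + 1) rfl rfl)) x
  have h₂ : ((mappingCone.snd φ).v (i + 1) (i + 1) (add_zero _)).hom
      (((mappingCone φ).d i (i + 1)).hom x) = (φ.f (i + 1)).hom a + (G.d i (i + 1)).hom b :=
    LinearMap.congr_fun (congrArg ModuleCat.Hom.hom (mappingCone.d_snd_v φ i (i + 1) rfl)) x
  have h₃ : ((mappingCone.inl φ).v (i + 1) i (by lia)).hom a + ((mappingCone.inr φ).f i).hom b =
      x :=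
    LinearMap.congr_fun (congrArg ModuleCat.Hom.hom (mappingCone.id_X φ i (i + 1) rfl)) x
  rw [hx, map_zero] at h₁ h₂
  rw [zero_eq_neg] at h₁
  obtain ⟨c, hc₁, hc₂⟩ := h i (i + 1) _ rfl rfl a b h₁ h₂.symm
  have h₄ : ((mappingCone φ).d (i - 1) i).hom
      (((mappingCone.inl φ).v i (i - 1) (by lia)).hom c) =
      ((mappingCone.inr φ).f i).hom ((φ.f i).hom c) -
        ((mappingCone.inl φ).v (i + 1) i (by lia)).hom ((F.d i (i + 1)).hom c) :=
    LinearMap.congr_fun (congrArg ModuleCat.Hom.hom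
      (mappingCone.inl_v_d φ i (i - 1) (i + 1) (by lia) (by lia))) c
  refine ⟨_, h₄.trans (Eq.trans ?_ h₃)⟩
  erw [hc₁, hc₂]
  rw [map_neg, sub_neg_eq_add, add_comm]

namespace SHat

open CochainComplex

variable {k : Type u} [Field k]

section Bar

variable (N : ℤ → Type u) [∀ i, AddCommGroup (N i)] [∀ i, Module k (N i)]

/-- The finitely supported families of elements of `N j`, for `j ≥ i`. -/
def barSpace (i : ℤ) : Submodule k (∀ j, N j) where
  carrier := {f | (∀ j < i, f j = 0) ∧ ∃ n : ℕ, ∀ j ≥ i + n, f j = 0}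
  zero_mem' := ⟨fun _ _ => rfl, 0, fun _ _ => rfl⟩
  add_mem' := by
    rintro f g ⟨hf, n, hn⟩ ⟨hg, m, hm⟩
    refine ⟨fun j hj => ?_, max n m, fun j hj => ?_⟩
    · rw [Pi.add_apply, hf j hj, hg j hj, add_zero]
    · rw [Pi.add_apply, hn j (by lia), hm j (by lia), add_zero]
  smul_mem' := by
    rintro c f ⟨hf, n, hn⟩
    refine ⟨fun j hj => ?_, n, fun j hj => ?_⟩
    · rw [Pi.smul_apply, hf j hj, smul_zero]
    · rw [Pi.smul_apply, hn j hj, smul_zero]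

variable {N}

lemma barSpace_ext {i : ℤ} {f g : barSpace (k := k) N i} (h : ∀ l ≥ i, f.1 l = g.1 l) : f = g := by
  refine Subtype.ext (funext fun l => ?_)
  by_cases hl : i ≤ l
  · exact h l hl
  · rw [f.2.1 l (by lia), g.2.1 l (by lia)]

/-- The truncation maps between the spaces of families. -/
def barD (i j : ℤ) (h : i + 1 = j) : barSpace (k := k) N i →ₗ[k] barSpace (k := k) N j where
  toFun f := ⟨fun l => if j ≤ l then f.1 l else 0, fun l hl => if_neg (by lia), by
    obtain ⟨-, n, hn⟩ := f.2
    refine ⟨n, fun l hl => ?_⟩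
    dsimp only
    rw [hn l (by lia), ite_self]⟩
  map_add' f g := barSpace_ext fun l hl => by simp [hl]
  map_smul' c f := barSpace_ext fun l hl => by simp [hl]

lemma barD_apply (i j : ℤ) (h : i + 1 = j) (f : barSpace (k := k) N i) {l : ℤ} (hl : j ≤ l) :
    (barD i j h f).1 l = f.1 l := if_pos hl

variable [∀ i, Module (DualNumber k) (N i)] [∀ i, IsScalarTower k (DualNumber k) (N i)]
  (dN : ∀ i j : ℤ, N i →ₗ[DualNumber k] N j)

/-- The maps between the spaces of families induced by the differential `d` of `N` and the action of
`ε`: the component of degree `l` of the image of `f` is `± (ε f^l - d f^{l - 1})`. -/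
def barD₀ (i j : ℤ) (h : i + 1 = j) : barSpace (k := k) N i →ₗ[k] barSpace (k := k) N j where
  toFun f := ⟨fun l => if j ≤ l then (i + l).negOnePow • ((DualNumber.eps : DualNumber k) • f.1 l -
      dN (l - 1) l (f.1 (l - 1))) else 0, fun l hl => if_neg (by lia), by
    obtain ⟨-, n, hn⟩ := f.2
    refine ⟨n, fun l hl => ?_⟩
    dsimp only
    rw [hn l (by lia), hn (l - 1) (by lia), smul_zero, map_zero, sub_zero, smul_zero, ite_self]⟩
  map_add' f g := barSpace_ext fun l hl => by
    simp only [hl, if_true, Submodule.coe_add, Pi.add_apply, smul_add, map_add,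
      add_sub_add_comm]
  map_smul' c f := barSpace_ext fun l hl => by
    simp only [hl, if_true, Submodule.coe_smul, Pi.smul_apply, RingHom.id_apply,
      LinearMap.map_smul_of_tower, smul_comm _ c, ← smul_sub]

lemma barD₀_apply (i j : ℤ) (h : i + 1 = j) (f : barSpace (k := k) N i) {l : ℤ} (hl : j ≤ l) :
    (barD₀ dN i j h f).1 l = (i + l).negOnePow • ((DualNumber.eps : DualNumber k) • f.1 l -
      dN (l - 1) l (f.1 (l - 1))) := if_pos hl

/-- The bar resolution of a complex `N` of `k[ε]`-modules, as a complex of free modules. The space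
`V^i` consists of the finitely supported families of elements of the `N^j` for `j ≥ i`: the copy of
`N^j` in it is the term `ε ⊗ ⋯ ⊗ ε ⊗ N^j` of the bar construction with `j - i` factors `ε`. -/
def bar (hd : ∀ i j l (x : N i), dN j l (dN i j x) = 0) : FreeComplex k where
  X i := ModuleCat.of k (barSpace (k := k) N i)
  d := barD
  d₀ := barD₀ dN
  d₀_d₀ i j l hij hjl f := barSpace_ext fun m hm => by
    have hs : (i + (m - 1)).negOnePow = - (i + m).negOnePow := by
      rw [← add_sub_assoc, Int.negOnePow_sub, Int.negOnePow_one, mul_neg, mul_one]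
    rw [barD₀_apply dN j l hjl _ hm, barD₀_apply dN i j hij _ (by lia),
      barD₀_apply dN i j hij _ (by lia), hs]
    change _ = (0 : N m)
    rcases Int.units_eq_one_or (i + m).negOnePow with h₁ | h₁ <;>
    rcases Int.units_eq_one_or (j + m).negOnePow with h₂ | h₂ <;>
    simp [h₁, h₂, Units.neg_smul, smul_sub, smul_smul, hd]
  d_d₀ i j l hij hjl f := barSpace_ext fun m hm => by
    have hs : (j + m).negOnePow = - (i + m).negOnePow := by
      rw [← hij, add_right_comm, Int.negOnePow_succ]
    rw [barD_apply j l hjl _ hm, barD₀_apply dN i j hij _ (by lia)]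
    change _ = -((barD₀ dN j l hjl (barD i j hij f)).1 m)
    rw [barD₀_apply dN j l hjl _ hm, barD_apply i j hij _ (by lia), barD_apply i j hij _ (by lia),
      hs, Units.neg_smul, neg_neg]

lemma locallyNilpotent_bar (hd : ∀ i j l (x : N i), dN j l (dN i j x) = 0) :
    (bar (k := k) dN hd).toSHat.LocallyNilpotent := by
  have key (n : ℕ) : ∀ (i : ℤ) (f : barSpace (k := k) N i), (∀ l ≥ i + n, f.1 l = 0) →
      f ∈ (bar (k := k) dN hd).toSHat.kerPow n i := by
    induction n with
    | zero => exact fun i f hf => barSpace_ext fun l hl => hf l (by simpa using hl)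
    | succ n ih =>
      refine fun i f hf => ih (i + 1) (barD i (i + 1) rfl f) fun l hl => ?_
      rw [barD_apply i (i + 1) rfl f (by lia)]
      exact hf l (by push_cast; lia)
  exact fun i f => ⟨_, key _ i f f.2.2.choose_spec⟩

/-- The augmentation of the bar resolution, on the generators: the component of degree `i`. -/
def barAug (i : ℤ) : barSpace (k := k) N i →ₗ[k] N i where
  toFun f := f.1 i
  map_add' _ _ := rfl
  map_smul' _ _ := rfl

lemma barAug_comm (i j : ℤ) (h : i + 1 = j) (f : barSpace (k := k) N i) :
    dN i j (barAug i f) =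
      barAug j (barD₀ dN i j h f) + (DualNumber.eps : DualNumber k) • barAug j (barD i j h f) := by
  subst h
  change _ = (barD₀ dN i (i + 1) rfl f).1 (i + 1) +
    DualNumber.eps • (barD i (i + 1) rfl f).1 (i + 1)
  rw [barD₀_apply dN i _ rfl _ le_rfl, barD_apply i _ rfl _ le_rfl, ← add_assoc,
    Int.negOnePow_succ, Int.negOnePow_even _ (Even.add_self i), Units.neg_smul, one_smul, neg_sub,
    sub_add_cancel]
  have (l : ℤ) (hl : l = i) : dN i (i + 1) (f.1 i) = dN l (i + 1) (f.1 l) := by subst hl; rfl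
  exact this _ (by lia)

/-- The element of `k[ε] ⊗ V^i`, here `1 ⊗ c`, that shows that the mapping cone of the augmentation
is acyclic: for a cocycle with components `v + ε w` and `b`, the family `c` has component `b` in
degree `i` and `-w` in the other degrees. -/
lemma exists_bar_lift (i j l : ℤ) (hij : i + 1 = j) (hjl : j + 1 = l)
    (v w : barSpace (k := k) N j) (b : N i)
    (hvw : barD₀ dN j l hjl w + barD j l hjl v = 0)
    (hb : barAug j v + (DualNumber.eps : DualNumber k) • barAug j w + dN i j b = 0) :
    ∃ c : barSpace (k := k) N i,
      barD₀ dN i j hij c = -v ∧ barD i j hij c = -w ∧ barAug i c = b := by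
  obtain ⟨m, hm⟩ := w.2.2
  let c : barSpace (k := k) N i := ⟨fun n => if h : n = i then h ▸ b else -w.1 n, fun n hn => by
    dsimp only
    rw [dif_neg (by lia), w.2.1 n (by lia), neg_zero], m + 1, fun n hn => by
    dsimp only
    rw [dif_neg (by lia), hm n (by push_cast at hn; lia), neg_zero]⟩
  have hc {n : ℤ} (hn : n ≠ i) : c.1 n = -w.1 n := dif_neg hn
  have hci : c.1 i = b := dif_pos rfl
  refine ⟨c, barSpace_ext fun n hn => ?_, barSpace_ext fun n hn => ?_, hci⟩
  · rw [barD₀_apply dN i j hij c hn, hc (by lia)]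
    change _ = -v.1 n
    rcases hn.lt_or_eq with hn' | rfl
    · have h₁ : (barD₀ dN j l hjl w).1 n + (barD j l hjl v).1 n = 0 :=
        congrFun (congrArg Subtype.val hvw) n
      have hs : (j + n).negOnePow = - (i + n).negOnePow := by
        rw [← hij, add_right_comm, Int.negOnePow_succ]
      rw [barD₀_apply dN j l hjl w (by lia), barD_apply j l hjl v (by lia), hs] at h₁
      rw [hc (by lia), ← eq_neg_of_add_eq_zero_left h₁]
      simp [Units.neg_smul, sub_eq_add_neg]
    · subst hij
      have (n : ℤ) (hn : n = i) : dN n (i + 1) (c.1 n) = dN i (i + 1) b := by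
        rw [← hci]; subst hn; rfl
      rw [this (i + 1 - 1) (by lia), ← add_assoc, Int.negOnePow_succ,
        Int.negOnePow_even _ (Even.add_self i), Units.neg_smul, one_smul]
      rw [add_assoc] at hb
      change v.1 (i + 1) + (DualNumber.eps • w.1 (i + 1) + dN i (i + 1) b) = 0 at hb
      rw [eq_neg_of_add_eq_zero_left hb, smul_neg]
      abel
  · rw [barD_apply i j hij c hn, hc (by lia)]
    rfl

end Bar

lemma liftBaseChange_eq {V N : Type u} [AddCommGroup V] [Module k V] [AddCommGroup N]
    [Module k N] [Module (DualNumber k) N] [IsScalarTower k (DualNumber k) N] (f : V →ₗ[k] N)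
    (x : DualNumber k ⊗[k] V) :
    f.liftBaseChange (DualNumber k) x =
      f (re V x) + (DualNumber.eps : DualNumber k) • f (im V x) := by
  conv_lhs => rw [← one_tmul_re_add_eps_tmul_im x]
  rw [map_add, LinearMap.liftBaseChange_tmul, LinearMap.liftBaseChange_tmul, one_smul]

/-- Every complex of `k[ε]`-modules receives a morphism with an acyclic cone from the complex of a
locally nilpotent sequence: the minimal model of its bar resolution. -/
theorem exists_locallyNilpotent_resolution
    (M : CochainComplex (ModuleCat.{u} (DualNumber k)) ℤ) :
    ∃ V : SHat k, V.LocallyNilpotent ∧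
      ∃ f : (toK k).obj V ⟶ (HomotopyCategory.quotient _ _).obj M,
        (HomotopyCategory.subcategoryAcyclic _).trW f := by
  let (i : ℤ) : Module k (M.X i) := Module.compHom _ (algebraMap k (DualNumber k))
  have (i : ℤ) : IsScalarTower k (DualNumber k) (M.X i) :=
    .of_algebraMap_smul fun _ _ => rfl
  let dM (i j : ℤ) : M.X i →ₗ[DualNumber k] M.X j := (M.d i j).hom
  let F : FreeComplex k := bar (N := fun i => M.X i) dM
    (fun i j l x => LinearMap.congr_fun (congrArg ModuleCat.Hom.hom (M.d_comp_d i j l)) x)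
  let π (i : ℤ) : F.X i →ₗ[k] M.X i := barAug (N := fun i => M.X i) i
  let aug (i : ℤ) : DualNumber k ⊗[k] F.X i →ₗ[DualNumber k] M.X i :=
    (π i).liftBaseChange (DualNumber k)
  have haug (i : ℤ) (x : DualNumber k ⊗[k] F.X i) :
      aug i x = π i (re _ x) + (DualNumber.eps : DualNumber k) • π i (im _ x) :=
    liftBaseChange_eq _ x
  let φ : F.total ⟶ M :=
    { f := fun i => ModuleCat.ofHom (aug i)
      comm' := fun i j hij => by
        have hij' : i + 1 = j := hij
        rw [F.total_d hij']
        refine ModuleCat.hom_ext (ext_one_tmul fun v => ?_)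
        change dM i j (aug i (1 ⊗ₜ v)) =
          aug j (extMap DualNumber.eps (F.d₀ i j hij') (F.d i j hij') (1 ⊗ₜ v))
        rw [haug, haug, re_extMap, im_extMap]
        simp only [re_tmul, im_tmul, TrivSqZeroExt.fst_one, TrivSqZeroExt.snd_one, one_smul,
          zero_smul, map_zero, smul_zero, add_zero, zero_add]
        exact barAug_comm dM i j hij' v }
  have hφ : (mappingCone φ).Acyclic := by
    refine mappingCone_acyclic_of_forall_exists φ
      fun i j l hij hjl (a : DualNumber k ⊗[k] F.X j) b ha hb => ?_
    rw [F.total_d hjl] at ha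
    change extMap DualNumber.eps (F.d₀ j l hjl) (F.d j l hjl) a = 0 at ha
    have ha' : F.d₀ j l hjl (im _ a) + F.d j l hjl (re _ a) = 0 := by
      rw [← im_extMap, ha, map_zero]
    have hb' := (congrArg (· + dM i j b) (haug j a)).symm.trans hb
    obtain ⟨c, hc₁, hc₂, hc₃⟩ : ∃ c : F.X i, F.d₀ i j hij c = -re (F.X j) a ∧
        F.d i j hij c = -im (F.X j) a ∧ π i c = b := exists_bar_lift dM i j l hij hjl _ _ b ha' hb'
    have hre : re (F.X i) (1 ⊗ₜ[k] c) = c := by simp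
    have him : im (F.X i) (1 ⊗ₜ[k] c) = 0 := by simp
    refine ⟨(1 : DualNumber k) ⊗ₜ[k] c, ?_, ?_⟩
    · rw [F.total_d hij]
      change extMap DualNumber.eps (F.d₀ i j hij) (F.d i j hij) (1 ⊗ₜ c) = -a
      refine dualNumber_tensor_ext ?_ ?_
      · rw [re_extMap, map_neg, hre]
        exact hc₁
      · rw [im_extMap, map_neg, hre, him, map_zero, zero_add]
        exact hc₂
    · refine (haug i _).trans ?_
      rw [hre, him, map_zero, smul_zero, add_zero]
      exact hc₃
  obtain ⟨S⟩ := F.nonempty_splitting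
  let e := HomotopyCategory.isoOfHomotopyEquiv S.homotopyEquiv
  refine ⟨S.model, S.locallyNilpotent_model (locallyNilpotent_bar _ _),
    e.inv ≫ (HomotopyCategory.quotient _ _).map φ, ?_⟩
  have hφ' : (HomotopyCategory.subcategoryAcyclic _).trW
      (e.inv ≫ (HomotopyCategory.quotient _ _).map φ) :=
    (MorphismProperty.cancel_left_of_respectsIso _ _ _).2
      ⟨_, _, _, HomotopyCategory.mappingCone_triangleh_distinguished φ,
        (HomotopyCategory.quotient_obj_mem_subcategoryAcyclic_iff_acyclic _).2 hφ⟩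
  exact hφ'

end SHat

/-! ### The semiorthogonal decomposition and the derived category -/

namespace SHat

variable {k : Type u} [Field k]

lemma LocallyNilpotent.hproj {V : SHat k} (hV : V.LocallyNilpotent) : hproj k V :=
  (CochainComplex.isKProjective_iff_leftOrthogonal _).1 hV.isKProjective

scoped instance : (acyclic k).IsClosedUnderIsomorphisms :=
  inferInstanceAs
    ((HomotopyCategory.subcategoryAcyclic _).inverseImage (toK k)).IsClosedUnderIsomorphisms

scoped instance : (hproj k).IsClosedUnderIsomorphisms :=
  inferInstanceAs ((HomotopyCategory.subcategoryAcyclic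
    (ModuleCat.{u} (DualNumber k))).leftOrthogonal.inverseImage (toK k)).IsClosedUnderIsomorphisms

scoped instance : (acyclic k).IsTriangulated :=
  inferInstanceAs ((HomotopyCategory.subcategoryAcyclic _).inverseImage (toK k)).IsTriangulated

scoped instance : (hproj k).IsTriangulated :=
  inferInstanceAs ((HomotopyCategory.subcategoryAcyclic
    (ModuleCat.{u} (DualNumber k))).leftOrthogonal.inverseImage (toK k)).IsTriangulated

variable (k) in
theorem isSemiorthogonalDecomposition :
    IsSemiorthogonalDecomposition (acyclic k) (hproj k) where
  isoClosed_left := inferInstance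
  isoClosed_right := inferInstance
  triangulated_left := inferInstance
  triangulated_right := inferInstance
  hom_eq_zero X Y f hX hY :=
    (toK k).map_injective ((hX ((toK k).map f) hY).trans ((toK k).map_zero _ _).symm)
  exists_triangle X := by
    obtain ⟨V, hV, f, hf⟩ := exists_locallyNilpotent_resolution X.toComplex
    obtain ⟨f, rfl⟩ := (toK k).map_surjective (X := V) (Y := X) f
    obtain ⟨A, g, h, hT, hA⟩ := (ObjectProperty.inverseImage_trW_iff _ (toK k) f).2 hf
    exact ⟨V, A, f, g, h, hV.hproj, hA, hT⟩

section Derived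

variable (k) [HasDerivedCategory.{w} (ModuleCat.{u} (DualNumber k))]

/-- The functor from `Ŝ_p` to the derived category sending a sequence to its complex. -/
noncomputable abbrev toDerived : (hproj k).FullSubcategory ⥤
    DerivedCategory (ModuleCat.{u} (DualNumber k)) :=
  (hproj k).ι ⋙ toK k ⋙ DerivedCategory.Qh

lemma toDerived_map_bijective (X Y : (hproj k).FullSubcategory) :
    Function.Bijective ((toDerived k).map : (X ⟶ Y) → _) := by
  have h₁ := X.property.map_bijective_of_isTriangulated DerivedCategory.Qh ((toK k).obj Y.obj)
  exact (h₁.comp ((Functor.FullyFaithful.ofFullyFaithful (toK k)).map_bijective X.obj Y.obj)).comp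
    ((hproj k).fullyFaithfulι.map_bijective X Y)

instance : (toDerived k).Full where
  map_surjective := (toDerived_map_bijective k _ _).2

instance : (toDerived k).Faithful where
  map_injective h := (toDerived_map_bijective k _ _).1 h

instance : (toDerived k).EssSurj where
  mem_essImage Y := by
    let e := DerivedCategory.Qh.objObjPreimageIso Y
    obtain ⟨M, hM⟩ := HomotopyCategory.quotient_obj_surjective (DerivedCategory.Qh.objPreimage Y)
    obtain ⟨V, hV, f, hf⟩ := exists_locallyNilpotent_resolution M
    have := Localization.inverts DerivedCategory.Qh (HomotopyCategory.subcategoryAcyclic _).trW f hf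
    exact ⟨⟨V, hV.hproj⟩, ⟨asIso (DerivedCategory.Qh.map f) ≪≫
      eqToIso (by rw [hM]) ≪≫ e⟩⟩

instance : (toDerived k).IsEquivalence where

end Derived

end SHat

open Pretriangulated in
theorem mainTheorem5 (k : Type u) [Field k]
    [HasDerivedCategory.{w} (ModuleCat.{u} (DualNumber k))] :
    (SHat.toMinimal k).IsEquivalence ∧ (SHat.toMinimal k).Linear k ∧
    ∃ (_ : (SHat.minimal k).IsTriangulated) (_ : Pretriangulated (SHat k)),
      (distTriang (SHat k) = {T | (SHat.toMinimal k).mapTriangle.obj T ∈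
        distTriang (SHat.minimal k).FullSubcategory}) ∧
      IsTriangulated (SHat k) ∧
      IsSemiorthogonalDecomposition (SHat.acyclic k) (SHat.hproj k) ∧
      ∃ (_ : (SHat.hproj k).IsTriangulated)
        (F : (SHat.hproj k).FullSubcategory ⥤
          DerivedCategory (ModuleCat.{u} (DualNumber k)))
        (_ : F.CommShift ℤ), F.IsTriangulated ∧ F.Linear k ∧ F.IsEquivalence :=
  -- the triangulated structures constructed above are scoped instances
  open SHat in
  ⟨inferInstance, inferInstance, inferInstance, inferInstance, rfl, inferInstance,
    isSemiorthogonalDecomposition k, inferInstance, toDerived k, inferInstance, inferInstance,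
    inferInstance, inferInstance⟩
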